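/- Let $Q$ be a finite-dimensional smooth ($C^\infty$, without boundary) manifold with a symplectic form $\omega$, i.e. a smooth, closed, nondegenerate differential 2-form. Let $\Gamma$ be a compact Lie group acting smoothly on $Q$ such that $\omega$ is $\Gamma$-invariant: for every $g\in\Gamma$ the diffeomorphism $\Phi_g : Q\to Q$, $\Phi_g(x)=g\cdot x$, satisfies $\Phi_g^*\omega=\omega$. Let $q\in Q$ be a fixed point of the action, $g\cdot q=q$ for all $g\in\Gamma$, and let $\Gamma$ act on the tangent space $T_qQ$ by the linearized action $g\cdot v = T_q\Phi_g(v)$. Regard $T_qQ$ as a symplectic vector space with the constant symplectic form $\omega(q)$. Then there are an open $\Gamma$-invariant neighborhood $U\subset Q$ of $q$, an open $\Gamma$-invariant neighborhood $V\subset T_qQ$ of $0$, and a $\Gamma$-equivariant symplectic diffeomorphism $f:(U,\omega)\to(V,\omega(q))$ with $f(q)=0$. That is, $f:U\to V$ is a smooth bijection with smooth inverse, $f(g\cdot x)=g\cdot f(x)$ for all $g\in\Gamma$ and $x\in U$, and $\omega(q)\big(T_xf\,v,\,T_xf\,w\big)=\omega(x)(v,w)$ for all $x\in U$ and $v,w\in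 T_xQ$. -/

import Mathlib

open scoped Manifold ContDiff

noncomputable section

namespace EquivariantDarboux

variable {E : Type*} [NormedAddCommGroup E] [NormedSpace ℝ E]
  {Q : Type*} [TopologicalSpace Q] [ChartedSpace E Q]

/-- A (not necessarily smooth) differential 2-form on the manifold `Q`. -/
abbrev TwoForm (E : Type*) [NormedAddCommGroup E] [NormedSpace ℝ E]
    (Q : Type*) [TopologicalSpace Q] [ChartedSpace E Q] : Type _ :=
  (x : Q) → TangentSpace 𝓘(ℝ, E) x [⋀^Fin 2]→L[ℝ] ℝ

/-- The coordinate expression of a 2-form in a chart `e`: its pullback along `e⁻¹`.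
It is meaningful on `e.target` only. -/
def TwoForm.inChart (Ω : TwoForm E Q) (e : OpenPartialHomeomorph Q E) (y : E) :
    E [⋀^Fin 2]→L[ℝ] ℝ :=
  (Ω (e.symm y)).compContinuousLinearMap (mfderiv 𝓘(ℝ, E) 𝓘(ℝ, E) e.symm y)

/-- A symplectic form: a smooth, closed, nondegenerate 2-form. Smoothness and closedness are
expressed in all smooth charts. -/
structure TwoForm.IsSymplectic (Ω : TwoForm E Q) : Prop where
  smooth : ∀ e ∈ IsManifold.maximalAtlas 𝓘(ℝ, E) ∞ Q, ContDiffOn ℝ ∞ (Ω.inChart e) e.target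
  closed : ∀ e ∈ IsManifold.maximalAtlas 𝓘(ℝ, E) ∞ Q, ∀ y ∈ e.target,
    extDeriv (Ω.inChart e) y = 0
  nondegenerate : ∀ (x : Q) (v : TangentSpace 𝓘(ℝ, E) x), (∀ w, Ω x ![v, w] = 0) → v = 0

/-- The differential at `x` of the diffeomorphism `x ↦ g • x`. -/
def smulDeriv {Γ : Type*} [SMul Γ Q] (g : Γ) (x : Q) :
    TangentSpace 𝓘(ℝ, E) x →L[ℝ] TangentSpace 𝓘(ℝ, E) (g • x) :=
  mfderiv 𝓘(ℝ, E) 𝓘(ℝ, E) (fun y : Q => g • y) x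

/-- `Ω` is invariant under the action of `Γ`: every `g` pulls `Ω` back to itself. -/
def TwoForm.IsInvariant (Γ : Type*) [SMul Γ Q] (Ω : TwoForm E Q) : Prop :=
  ∀ (g : Γ) (x : Q), (Ω (g • x)).compContinuousLinearMap (smulDeriv g x) = Ω x

/-- The identity map between the tangent spaces at two equal points. -/
def tangentCast {x y : Q} (h : x = y) :
    TangentSpace 𝓘(ℝ, E) x →L[ℝ] TangentSpace 𝓘(ℝ, E) y :=
  h ▸ ContinuousLinearMap.id ℝ (TangentSpace 𝓘(ℝ, E) x)

/-- The linearized action of `Γ` on the tangent space at a fixed point `q`. -/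
def linearizedAction {Γ : Type*} [SMul Γ Q] {q : Q} (hq : ∀ g : Γ, g • q = q) (g : Γ) :
    TangentSpace 𝓘(ℝ, E) q →L[ℝ] TangentSpace 𝓘(ℝ, E) q :=
  (tangentCast (hq g)).comp (smulDeriv g q)

/-- A linear homeomorphism between `T_q Q` and the model space. It provides the
vector space `T_q Q` with its smooth structure (any other one gives the same structure). -/
def tangentModel (q : Q) : TangentSpace 𝓘(ℝ, E) q ≃L[ℝ] E :=
  ContinuousLinearEquiv.refl ℝ E

/-- The differential at `x` of a map `f` from `Q` to the vector space `T_q Q`, where the tangent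
spaces of `T_q Q` are identified with `T_q Q` itself. -/
def vectorDeriv {q : Q} (f : Q → TangentSpace 𝓘(ℝ, E) q) (x : Q) :
    TangentSpace 𝓘(ℝ, E) x →L[ℝ] TangentSpace 𝓘(ℝ, E) q :=
  (tangentModel (E := E) q).symm.toContinuousLinearMap.comp
    ((NormedSpace.fromTangentSpace (𝕜 := ℝ) (tangentModel q (f x))).toContinuousLinearMap.comp
      (mfderiv 𝓘(ℝ, E) 𝓘(ℝ, E) (fun z => tangentModel q (f z)) x))

/-- `f` is a symplectic diffeomorphism from the open set `f.source` of `(Q, Ω)` onto the open set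
`f.target` of the vector space `T_q Q` with the constant form `Ω(q)`. -/
structure IsSymplectomorphismToTangent (Ω : TwoForm E Q) {q : Q}
    (f : OpenPartialHomeomorph Q (TangentSpace 𝓘(ℝ, E) q)) : Prop where
  smooth : ContMDiffOn 𝓘(ℝ, E) 𝓘(ℝ, E) ∞ (fun x => tangentModel q (f x)) f.source
  smooth_symm : ContMDiffOn 𝓘(ℝ, E) 𝓘(ℝ, E) ∞ (fun y : E => f.symm ((tangentModel q).symm y))
    ((tangentModel q).symm ⁻¹' f.target)
  pullback : ∀ x ∈ f.source, (Ω q).compContinuousLinearMap (vectorDeriv f x) = Ω x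

end EquivariantDarboux

end

open EquivariantDarboux

/-!
Averaging the translates of a chart over the compact group gives a chart in which the action is
linear, so that the claim becomes local at the origin of a linear representation. There the Moser
path `η + t (η₀ - η)` of closed forms, `η₀` being the constant form `η 0`, consists of
nondegenerate forms near the origin. The radial primitive of `η₀ - η` is invariant and vanishes to
second order at the origin, hence so does the time-dependent vector field which the path of forms
turns it into; the time-one map of its flow is therefore defined near the origin, commutes with the
action and pulls `η₀` back to `η`.

The smooth dependence of the flow on the initial point is obtained by solving the integral equation
of the flow with the inverse function theorem in the Banach space of continuous curves, where the
vector field acts as a superposition operator. The same operators, over the group instead of the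
time interval, give the smoothness of the averaged chart.
-/

noncomputable section

namespace EquivariantDarboux

open Set Filter Topology MeasureTheory Function

universe u

set_option maxSynthPendingDepth 3

section Superposition

variable {K : Type*} [TopologicalSpace K] {E F : Type u} [NormedAddCommGroup E]
  [NormedAddCommGroup F]

/-- The continuous maps from `K` to `E` with values in `W`. -/
def mapsInto (K : Type*) [TopologicalSpace K] (W : Set E) : Set C(K, E) :=
  {w | ∀ k, w k ∈ W}

/-- The superposition (Nemytskii) operator `w ↦ (k ↦ f k (w k))` of a family of maps `f`. It has
the junk value `0` at those `w` for which `k ↦ f k (w k)` is not continuous. -/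
def superposition (f : K → E → F) (w : C(K, E)) : C(K, F) :=
  ContinuousMap.mkD (fun k => f k (w k)) 0

lemma superposition_apply {f : K → E → F} {W : Set E}
    (hf : ContinuousOn (uncurry f) (univ ×ˢ W)) {w : C(K, E)} (hw : w ∈ mapsInto K W) (k : K) :
    superposition f w k = f k (w k) :=
  ContinuousMap.mkD_apply_of_continuous
    (hf.comp_continuous (continuous_id.prodMk w.continuous) fun k => ⟨mem_univ k, hw k⟩)

lemma superposition_zero {f : K → E → F} (hf : ∀ k, f k 0 = 0) : superposition f 0 = 0 := by
  ext k
  refine (ContinuousMap.mkD_apply_of_continuous ?_).trans (hf k)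
  simpa only [ContinuousMap.zero_apply, hf] using continuous_const

variable [CompactSpace K]

lemma isOpen_mapsInto {W : Set E} (hW : IsOpen W) : IsOpen (mapsInto K W) := by
  simpa only [MapsTo, mem_univ, true_implies] using!
    ContinuousMap.isOpen_setOfPred_mapsTo isCompact_univ hW

lemma exists_mapsInto_subset {N : Set C(K, E)} (hN : N ∈ 𝓝 0) :
    ∃ M ∈ 𝓝 (0 : E), mapsInto K M ⊆ N := by
  obtain ⟨r, hr, hrN⟩ := Metric.nhds_basis_closedBall.mem_iff.1 hN
  refine ⟨Metric.closedBall 0 r, Metric.closedBall_mem_nhds 0 hr, fun w hw => hrN ?_⟩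
  rw [mem_closedBall_zero_iff, ContinuousMap.norm_le _ hr.le]
  exact fun k => mem_closedBall_zero_iff.1 (hw k)

lemma continuousOn_superposition {f : K → E → F} {W : Set E}
    (hf : ContinuousOn (uncurry f) (univ ×ˢ W)) :
    ContinuousOn (superposition f) (mapsInto K W) := by
  rw [continuousOn_iff_continuous_domRestrict]
  refine ContinuousMap.continuous_of_continuous_uncurry _ ?_
  have h : Continuous fun p : mapsInto K W × K => f p.2 (p.1.1 p.2) :=
    hf.comp_continuous (continuous_snd.prodMk
      (continuous_eval.comp (continuous_subtype_val.prodMap continuous_id)))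
      fun p => ⟨mem_univ _, p.1.2 p.2⟩
  exact h.congr fun p => (superposition_apply hf p.1.2 p.2).symm

variable [NormedSpace ℝ E] [NormedSpace ℝ F]

/-- Pointwise application of a continuous family of linear maps, as a continuous linear map. -/
def pointwiseApply : C(K, E →L[ℝ] F) →L[ℝ] C(K, E) →L[ℝ] C(K, F) :=
  LinearMap.mkContinuous₂
    (LinearMap.mk₂ ℝ (fun (A : C(K, E →L[ℝ] F)) (w : C(K, E)) =>
        (⟨fun k => A k (w k), A.continuous.clm_apply w.continuous⟩ : C(K, F)))
      (fun _ _ _ => by ext; simp) (fun _ _ _ => by ext; simp)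
      (fun _ _ _ => by ext; simp) (fun _ _ _ => by ext; simp)) 1 (by
    intro A w
    rw [ContinuousMap.norm_le _ (by positivity), one_mul]
    exact fun k => (A k).le_of_opNorm_le_of_le (A.norm_coe_le_norm k) (w.norm_coe_le_norm k))

@[simp] lemma pointwiseApply_apply (A : C(K, E →L[ℝ] F)) (w : C(K, E)) (k : K) :
    pointwiseApply A w k = A k (w k) := rfl

lemma hasFDerivAt_superposition {f : K → E → F} {W : Set E} (hW : IsOpen W)
    (hf : ContinuousOn (uncurry f) (univ ×ˢ W)) (hd : ∀ k, ∀ x ∈ W, DifferentiableAt ℝ (f k) x)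
    (hf' : ContinuousOn (uncurry fun k x => fderiv ℝ (f k) x) (univ ×ˢ W)) {w : C(K, E)}
    (hw : w ∈ mapsInto K W) :
    HasFDerivAt (superposition f) (pointwiseApply (superposition (fun k x => fderiv ℝ (f k) x) w))
      w := by
  rw [hasFDerivAt_iff_isLittleO, Asymptotics.isLittleO_iff]
  intro c hc
  have hmem : mapsInto K W ∈ 𝓝 w := (isOpen_mapsInto hW).mem_nhds hw
  have hcont := ((continuousOn_superposition hf').continuousAt hmem).preimage_mem_nhds
    (Metric.closedBall_mem_nhds _ hc)
  obtain ⟨δ, hδ, hball⟩ := Metric.mem_nhds_iff.1 (inter_mem hmem hcont)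
  filter_upwards [Metric.ball_mem_nhds w hδ] with z hz
  rw [ContinuousMap.norm_le _ (by positivity)]
  intro k
  have hseg : ∀ y ∈ segment ℝ (w k) (z k),
      y ∈ W ∧ ‖fderiv ℝ (f k) y - fderiv ℝ (f k) (w k)‖ ≤ c := by
    intro y hy
    obtain ⟨θ, hθ, rfl⟩ := segment_eq_image_lineMap ℝ (w k) (z k) ▸ hy
    have hθball := hball ((convex_ball w δ).lineMap_mem (Metric.mem_ball_self hδ) hz hθ)
    have hθk : AffineMap.lineMap w z θ k = AffineMap.lineMap (w k) (z k) θ := by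
      simp [AffineMap.lineMap_apply]
    have hle := ((superposition (fun k x => fderiv ℝ (f k) x) (AffineMap.lineMap w z θ)
      - superposition (fun k x => fderiv ℝ (f k) x) w).norm_coe_le_norm k).trans
        (mem_closedBall_iff_norm.1 hθball.2)
    rw [ContinuousMap.sub_apply, superposition_apply hf' hθball.1, superposition_apply hf' hw,
      hθk] at hle
    exact ⟨hθk ▸ hθball.1 k, hle⟩
  have hmv := (convex_segment (w k) (z k)).norm_image_sub_le_of_norm_hasFDerivWithin_le'
    (fun y hy => (hd k y (hseg y hy).1).hasFDerivAt.hasFDerivWithinAt) (fun y hy => (hseg y hy).2)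
    (left_mem_segment ℝ _ _) (right_mem_segment ℝ _ _)
  rw [ContinuousMap.sub_apply, ContinuousMap.sub_apply, pointwiseApply_apply,
    superposition_apply hf (hball hz).1, superposition_apply hf hw, superposition_apply hf' hw]
  exact hmv.trans (mul_le_mul_of_nonneg_left ((z - w).norm_coe_le_norm k) hc.le)

variable {G : Type*} [NormedAddCommGroup G] [NormedSpace ℝ G] {H : Type*} [TopologicalSpace H]
  {J : ModelWithCorners ℝ G H} [ChartedSpace H K]

omit [CompactSpace K] in
lemma contDiffOn_of_contMDiffOn_uncurry {f : K → E → F} {W : Set E}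
    (hf : ContMDiffOn (J.prod 𝓘(ℝ, E)) 𝓘(ℝ, F) ∞ (uncurry f) (univ ×ˢ W)) (k : K) :
    ContDiffOn ℝ ∞ (f k) W := by
  rw [← contMDiffOn_iff_contDiffOn]
  exact hf.comp (contMDiff_const.prodMk contMDiff_id).contMDiffOn fun x hx => ⟨mem_univ k, hx⟩

variable [IsManifold J 1 K]

omit [CompactSpace K] in
lemma contMDiffOn_fderiv_snd {f : K → E → F} {W : Set E} (hW : IsOpen W)
    (hf : ContMDiffOn (J.prod 𝓘(ℝ, E)) 𝓘(ℝ, F) ∞ (uncurry f) (univ ×ˢ W)) :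
    ContMDiffOn (J.prod 𝓘(ℝ, E)) 𝓘(ℝ, E →L[ℝ] F) ∞ (uncurry fun k x => fderiv ℝ (f k) x)
      (univ ×ˢ W) := by
  intro p hp
  have hproj : ContMDiff ((J.prod 𝓘(ℝ, E)).prod 𝓘(ℝ, E)) (J.prod 𝓘(ℝ, E)) ∞
      (fun r : (K × E) × E => (r.1.1, r.2)) :=
    (contMDiff_fst.comp contMDiff_fst).prodMk contMDiff_snd
  have hfp : ContMDiffAt ((J.prod 𝓘(ℝ, E)).prod 𝓘(ℝ, E)) 𝓘(ℝ, F) ∞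
      (uncurry fun (p : K × E) (y : E) => f p.1 y) (p, p.2) :=
    (hf.contMDiffAt ((isOpen_univ.prod hW).mem_nhds hp)).comp (p, p.2) hproj.contMDiffAt
  have hderiv := ContMDiffAt.mfderiv (m := ∞) (fun (p : K × E) (y : E) => f p.1 y) Prod.snd hfp
    contMDiffAt_snd (by simp)
  have htriv := inTangentCoordinates_model_space (I := 𝓘(ℝ, E)) (I' := 𝓘(ℝ, F))
    (Prod.snd : K × E → E) (fun p : K × E => f p.1 p.2) (fun p => fderiv ℝ (f p.1) p.2) p
  simp only [mfderiv_eq_fderiv] at hderiv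
  rw [htriv] at hderiv
  exact ContMDiffAt.contMDiffWithinAt hderiv

lemma hasFDerivAt_superposition_of_contMDiffOn {f : K → E → F} {W : Set E} (hW : IsOpen W)
    (hf : ContMDiffOn (J.prod 𝓘(ℝ, E)) 𝓘(ℝ, F) ∞ (uncurry f) (univ ×ˢ W)) {w : C(K, E)}
    (hw : w ∈ mapsInto K W) :
    HasFDerivAt (superposition f) (pointwiseApply (superposition (fun k x => fderiv ℝ (f k) x) w))
      w :=
  hasFDerivAt_superposition hW hf.continuousOn
    (fun k x hx => ((contDiffOn_of_contMDiffOn_uncurry hf k).contDiffAt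
      (hW.mem_nhds hx)).differentiableAt (by simp))
    (contMDiffOn_fderiv_snd hW hf).continuousOn hw

theorem contDiffOn_superposition {f : K → E → F} {W : Set E} (hW : IsOpen W)
    (hf : ContMDiffOn (J.prod 𝓘(ℝ, E)) 𝓘(ℝ, F) ∞ (uncurry f) (univ ×ˢ W)) :
    ContDiffOn ℝ ∞ (superposition f) (mapsInto K W) := by
  rw [contDiffOn_infty]
  intro n
  induction n generalizing F with
  | zero => exact contDiffOn_zero.2 (continuousOn_superposition hf.continuousOn)
  | succ n ih =>
    have hderiv := fun w hw => hasFDerivAt_superposition_of_contMDiffOn hW hf (w := w) hw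
    rw [Nat.cast_succ, contDiffOn_succ_iff_fderiv_of_isOpen (isOpen_mapsInto hW)]
    refine ⟨fun w hw => (hderiv w hw).differentiableAt.differentiableWithinAt, by simp, ?_⟩
    refine ContDiffOn.congr ?_ fun w hw => (hderiv w hw).fderiv
    exact (pointwiseApply (K := K) (E := E) (F := F)).contDiff.comp_contDiffOn
      (ih (contMDiffOn_fderiv_snd hW hf))

end Superposition

section Integral

variable {K : Type*} [TopologicalSpace K] [CompactSpace K] [MeasurableSpace K] [BorelSpace K]
  {E F : Type u} [NormedAddCommGroup E] [NormedSpace ℝ E] [NormedAddCommGroup F] [NormedSpace ℝ F]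
  (μ : Measure K) [IsFiniteMeasure μ]

omit [NormedSpace ℝ F] in
lemma integrable_continuousMap (w : C(K, F)) : Integrable w μ :=
  w.continuous.integrable_of_hasCompactSupport (HasCompactSupport.of_compactSpace w)

/-- Integration against a finite measure on a compact space, as a continuous linear map. -/
def integralCLM : C(K, F) →L[ℝ] F :=
  LinearMap.mkContinuous
    { toFun := fun w => ∫ k, w k ∂μ
      map_add' := fun w z => integral_add (integrable_continuousMap μ w)
        (integrable_continuousMap μ z)
      map_smul' := fun c w => integral_smul c _ } (μ.real univ) (fun w => by
    rw [mul_comm]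
    exact norm_integral_le_of_norm_le_const (Eventually.of_forall w.norm_coe_le_norm))

lemma integral_eq_integralCLM_superposition {f : K → E → F} {W : Set E}
    (hf : ContinuousOn (uncurry f) (univ ×ˢ W)) {x : E} (hx : x ∈ W) :
    ∫ k, f k x ∂μ = integralCLM μ (superposition f (ContinuousLinearMap.const ℝ K x)) :=
  integral_congr_ae (Eventually.of_forall fun k =>
    (superposition_apply hf (w := ContinuousLinearMap.const ℝ K x) (fun _ => hx) k).symm)

variable {G : Type*} [NormedAddCommGroup G] [NormedSpace ℝ G] {H : Type*} [TopologicalSpace H]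
  {J : ModelWithCorners ℝ G H} [ChartedSpace H K] [IsManifold J 1 K]

theorem contDiffOn_integral {f : K → E → F} {W : Set E} (hW : IsOpen W)
    (hf : ContMDiffOn (J.prod 𝓘(ℝ, E)) 𝓘(ℝ, F) ∞ (uncurry f) (univ ×ˢ W)) :
    ContDiffOn ℝ ∞ (fun x => ∫ k, f k x ∂μ) W := by
  refine ContDiffOn.congr ?_
    fun x hx => integral_eq_integralCLM_superposition μ hf.continuousOn hx
  exact (integralCLM μ).contDiff.comp_contDiffOn ((contDiffOn_superposition hW hf).comp
    (ContinuousLinearMap.const ℝ K).contDiff.contDiffOn fun x hx _ => hx)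

theorem hasFDerivAt_integral [CompleteSpace F] {f : K → E → F} {W : Set E} (hW : IsOpen W)
    (hf : ContMDiffOn (J.prod 𝓘(ℝ, E)) 𝓘(ℝ, F) ∞ (uncurry f) (univ ×ˢ W)) {x : E} (hx : x ∈ W) :
    HasFDerivAt (fun x => ∫ k, f k x ∂μ) (∫ k, fderiv ℝ (f k) x ∂μ) x := by
  have hD := (contMDiffOn_fderiv_snd hW hf).continuousOn
  have hsup := hasFDerivAt_superposition_of_contMDiffOn hW hf
    (w := ContinuousLinearMap.const ℝ K x) fun _ => hx
  have hcomp := (integralCLM μ).hasFDerivAt.comp x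
    (hsup.comp x (ContinuousLinearMap.const ℝ K (M := E)).hasFDerivAt)
  refine (hcomp.congr_of_eventuallyEq ?_).congr_fderiv ?_
  · filter_upwards [hW.mem_nhds hx] with y hy
    exact integral_eq_integralCLM_superposition μ hf.continuousOn hy
  · ext v
    rw [integral_eq_integralCLM_superposition μ hD hx]
    exact (ContinuousLinearMap.integral_apply (integrable_continuousMap μ _) v).symm

end Integral

section Cartan

variable {𝕜 E F : Type*} [NontriviallyNormedField 𝕜] [NormedAddCommGroup E] [NormedSpace 𝕜 E]
  [NormedAddCommGroup F] [NormedSpace 𝕜 F] {n : ℕ}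

open ContinuousAlternatingMap

variable (𝕜 E F n) in
/-- The interior product `η ↦ (v ↦ ι_v η)` of alternating forms, as a continuous linear map. -/
def curryLeftCLM : (E [⋀^Fin (n + 1)]→L[𝕜] F) →L[𝕜] E →L[𝕜] E [⋀^Fin n]→L[𝕜] F :=
  curryLeftLI.toContinuousLinearMap

@[simp] lemma curryLeftCLM_apply (η : E [⋀^Fin (n + 1)]→L[𝕜] F) :
    curryLeftCLM 𝕜 E F n η = η.curryLeft := rfl

lemma alternatizeUncurryFin_curryLeft_flip_add (L : E →L[𝕜] E [⋀^Fin (n + 1)]→L[𝕜] F) (v : E) :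
    alternatizeUncurryFin ((curryLeftCLM 𝕜 E F n ∘L L).flip v) +
      (alternatizeUncurryFin L).curryLeft v = L v := by
  ext w
  have hcons (i : Fin (n + 1)) :
      i.succ.removeNth (Matrix.vecCons v w) = Matrix.vecCons v (i.removeNth w) :=
    Fin.cons_comp_succ_succAbove v w i
  simp [alternatizeUncurryFin_apply, Fin.sum_univ_succ (n := n + 1), pow_succ, hcons]

lemma hasFDerivAt_curryLeft_apply {η : E → E [⋀^Fin (n + 1)]→L[𝕜] F} {X : E → E} {x : E}
    {η' : E →L[𝕜] E [⋀^Fin (n + 1)]→L[𝕜] F} {X' : E →L[𝕜] E} (hη : HasFDerivAt η η' x)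
    (hX : HasFDerivAt X X' x) :
    HasFDerivAt (fun y => (η y).curryLeft (X y))
      ((η x).curryLeft ∘L X' + (curryLeftCLM 𝕜 E F n ∘L η').flip (X x)) x := by
  have hcurry : HasFDerivAt (fun y => (η y).curryLeft) (curryLeftCLM 𝕜 E F n ∘L η') x :=
    HasFDerivAt.comp (g := curryLeftCLM 𝕜 E F n) x (ContinuousLinearMap.hasFDerivAt _) hη
  exact hcurry.clm_apply hX

/-- Cartan's formula `dι_X + ι_X d = L_X`; the right-hand side is the Lie derivative of `η` along
`X` in coordinates. -/
theorem extDeriv_curryLeft_add_curryLeft_extDeriv {η : E → E [⋀^Fin (n + 1)]→L[𝕜] F}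
    {X : E → E} {x : E} (hη : DifferentiableAt 𝕜 η x) (hX : DifferentiableAt 𝕜 X x) :
    extDeriv (fun y => (η y).curryLeft (X y)) x + (extDeriv η x).curryLeft (X x) =
      fderiv 𝕜 η x (X x) + (η x).fderivCompContinuousLinearMap (.id 𝕜 E) (fderiv 𝕜 X x) := by
  have hid : (compContinuousLinearMapCLM (.id 𝕜 E) : (E [⋀^Fin n]→L[𝕜] F) →L[𝕜] _) = .id 𝕜 _ := by
    ext
    rfl
  rw [extDeriv, (hasFDerivAt_curryLeft_apply hη.hasFDerivAt hX.hasFDerivAt).fderiv,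
    alternatizeUncurryFin_add, add_assoc, extDeriv, alternatizeUncurryFin_curryLeft_flip_add,
    fderivCompContinuousLinearMap_eq_alternatizeUncurryFin, hid]
  exact add_comm _ _

end Cartan

section UnitInterval

variable {E F : Type*} [NormedAddCommGroup E] [NormedSpace ℝ E] [NormedAddCommGroup F]
  [NormedSpace ℝ F]

lemma contMDiffOn_uncurry_Icc {f : ℝ → E → F} {W : Set E}
    (hf : ContDiffOn ℝ ∞ (uncurry f) (Icc (0 : ℝ) 1 ×ˢ W)) :
    ContMDiffOn ((𝓡∂ 1).prod 𝓘(ℝ, E)) 𝓘(ℝ, F) ∞ (uncurry fun (t : Icc (0 : ℝ) 1) x => f t x)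
      (univ ×ˢ W) := by
  have hval : ContMDiff ((𝓡∂ 1).prod 𝓘(ℝ, E)) 𝓘(ℝ, ℝ × E) ∞
      (fun p : Icc (0 : ℝ) 1 × E => ((p.1 : ℝ), p.2)) :=
    (contMDiff_subtypeVal_Icc.comp contMDiff_fst).prodMk_space contMDiff_snd
  exact hf.contMDiffOn.comp hval.contMDiffOn fun p hp => ⟨p.1.2, hp.2⟩

lemma integral_Icc_eq_sub_of_hasDerivAt [CompleteSpace F] {f f' : ℝ → F}
    (hderiv : ∀ t ∈ Icc (0 : ℝ) 1, HasDerivAt f (f' t) t)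
    (hcont : ContinuousOn f' (Icc (0 : ℝ) 1)) :
    ∫ t : Icc (0 : ℝ) 1, f' t = f 1 - f 0 := by
  rw [← uIcc_of_le zero_le_one] at hderiv hcont
  rw [← intervalIntegral.integral_eq_sub_of_hasDerivAt hderiv hcont.intervalIntegrable,
    intervalIntegral.integral_of_le zero_le_one, ← integral_Icc_eq_integral_Ioc]
  exact integral_subtype_comap measurableSet_Icc f'

end UnitInterval

section RadialPrimitive

variable {E : Type u} [NormedAddCommGroup E] [NormedSpace ℝ E] {n : ℕ}

open ContinuousAlternatingMap

/-- The primitive of a closed form given by the Poincaré lemma: the contraction of the form with the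
radial vector field, integrated along the rays through the origin. -/
def radialPrimitive (η : E → E [⋀^Fin (n + 1)]→L[ℝ] ℝ) (x : E) : E [⋀^Fin n]→L[ℝ] ℝ :=
  ∫ t : Icc (0 : ℝ) 1, (t : ℝ) ^ n • (η ((t : ℝ) • x)).curryLeft x

variable {η : E → E [⋀^Fin (n + 1)]→L[ℝ] ℝ} {W : Set E}

lemma contMDiffOn_radialPrimitive_integrand (hη : ContDiffOn ℝ ∞ η W) (hW : StarConvex ℝ 0 W) :
    ContMDiffOn ((𝓡∂ 1).prod 𝓘(ℝ, E)) 𝓘(ℝ, E [⋀^Fin n]→L[ℝ] ℝ) ∞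
      (uncurry fun (t : Icc (0 : ℝ) 1) x => (t : ℝ) ^ n • (η ((t : ℝ) • x)).curryLeft x)
      (univ ×ˢ W) := by
  refine contMDiffOn_uncurry_Icc (f := fun t x => t ^ n • (η (t • x)).curryLeft x) ?_
  have hdil : ContDiffOn ℝ ∞ (fun p : ℝ × E => η (p.1 • p.2)) (Icc (0 : ℝ) 1 ×ˢ W) :=
    hη.comp (contDiff_fst.smul contDiff_snd).contDiffOn
      fun p hp => hW.smul_mem hp.2 hp.1.1 hp.1.2
  exact (contDiff_fst.pow n).contDiffOn.smul
    (((curryLeftCLM ℝ E ℝ n).contDiff.comp_contDiffOn hdil).clm_apply contDiff_snd.contDiffOn)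

lemma contDiffOn_radialPrimitive (hη : ContDiffOn ℝ ∞ η W) (hWo : IsOpen W)
    (hW : StarConvex ℝ 0 W) : ContDiffOn ℝ ∞ (radialPrimitive η) W :=
  contDiffOn_integral volume hWo (contMDiffOn_radialPrimitive_integrand hη hW)

lemma hasFDerivAt_radialPrimitive (hη : ContDiffOn ℝ ∞ η W) (hWo : IsOpen W)
    (hW : StarConvex ℝ 0 W) {x : E} (hx : x ∈ W) :
    HasFDerivAt (radialPrimitive η)
      (∫ t : Icc (0 : ℝ) 1, fderiv ℝ (fun y => (t : ℝ) ^ n • (η ((t : ℝ) • y)).curryLeft y) x) x :=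
  hasFDerivAt_integral volume hWo (contMDiffOn_radialPrimitive_integrand hη hW) hx

lemma hasFDerivAt_pow_smul_comp_smul {x : E} {t : ℝ} (hη : DifferentiableAt ℝ η (t • x)) :
    HasFDerivAt (fun y => t ^ n • η (t • y)) (t ^ (n + 1) • fderiv ℝ η (t • x)) x := by
  have hdil : HasFDerivAt (fun y : E => t • y) (t • .id ℝ E) x :=
    (hasFDerivAt_id x).const_smul t
  convert! (hη.hasFDerivAt.comp x hdil).const_smul (t ^ n) using 1
  rw [ContinuousLinearMap.comp_smul, ContinuousLinearMap.comp_id, smul_smul, pow_succ]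

lemma fderivCompContinuousLinearMap_id_id (θ : E [⋀^Fin (n + 1)]→L[ℝ] ℝ) :
    θ.fderivCompContinuousLinearMap (.id ℝ E) (.id ℝ E) = (n + 1) • θ := by
  ext v
  simp [fderivCompContinuousLinearMap_apply]

lemma hasDerivAt_pow_smul_comp_smul {x : E} {t : ℝ} (hη : DifferentiableAt ℝ η (t • x))
    (hclosed : extDeriv η (t • x) = 0) :
    HasDerivAt (fun s : ℝ => s ^ (n + 1) • η (s • x))
      (extDeriv (fun y => t ^ n • (η (t • y)).curryLeft y) x) t := by
  have hray : HasDerivAt (fun s : ℝ => η (s • x)) (fderiv ℝ η (t • x) x) t := by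
    simpa using! hη.hasFDerivAt.comp_hasDerivAt t ((hasDerivAt_id t).smul_const x)
  have hσ := hasFDerivAt_pow_smul_comp_smul hη
  have hσ_closed : extDeriv (fun y => t ^ n • η (t • y)) x = 0 := by
    rw [extDeriv, hσ.fderiv, alternatizeUncurryFin_smul, ← extDeriv, hclosed, smul_zero]
  have hcartan := extDeriv_curryLeft_add_curryLeft_extDeriv hσ.differentiableAt
    (differentiableAt_id (x := x))
  rw [hσ_closed, curryLeft_zero, hσ.fderiv, fderiv_id,
    fderivCompContinuousLinearMap_id_id] at hcartan
  convert! (hasDerivAt_pow (n + 1) t).smul hray using 1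
  simpa [smul_smul, ← Nat.cast_smul_eq_nsmul ℝ] using hcartan

theorem extDeriv_radialPrimitive (hη : ContDiffOn ℝ ∞ η W) (hWo : IsOpen W)
    (hW : StarConvex ℝ 0 W) (hclosed : ∀ x ∈ W, extDeriv η x = 0) {x : E} (hx : x ∈ W) :
    extDeriv (radialPrimitive η) x = η x := by
  have hray (t : ℝ) (ht : t ∈ Icc (0 : ℝ) 1) : t • x ∈ W := hW.smul_mem hx ht.1 ht.2
  have hD : Continuous fun t : Icc (0 : ℝ) 1 =>
      fderiv ℝ (fun y => (t : ℝ) ^ n • (η ((t : ℝ) • y)).curryLeft y) x :=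
    (contMDiffOn_fderiv_snd hWo (contMDiffOn_radialPrimitive_integrand hη hW)).continuousOn
      |>.comp_continuous (f := fun t => (t, x)) (by fun_prop) fun t => ⟨mem_univ t, hx⟩
  calc extDeriv (radialPrimitive η) x
      = ∫ t : Icc (0 : ℝ) 1, extDeriv (fun y => (t : ℝ) ^ n • (η ((t : ℝ) • y)).curryLeft y) x := by
        rw [extDeriv, (hasFDerivAt_radialPrimitive hη hWo hW hx).fderiv]
        exact ((alternatizeUncurryFinCLM ℝ E ℝ).integral_comp_comm
          (integrable_continuousMap volume ⟨_, hD⟩)).symm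
    _ = (1 : ℝ) ^ (n + 1) • η ((1 : ℝ) • x) - (0 : ℝ) ^ (n + 1) • η ((0 : ℝ) • x) := by
        refine integral_Icc_eq_sub_of_hasDerivAt (fun t ht => hasDerivAt_pow_smul_comp_smul
          ((hη.differentiableOn (by simp)).differentiableAt (hWo.mem_nhds (hray t ht)))
          (hclosed _ (hray t ht))) ?_
        rw [continuousOn_iff_continuous_domRestrict]
        exact (alternatizeUncurryFinCLM ℝ E ℝ).continuous.comp hD
    _ = η x := by simp

lemma radialPrimitive_zero : radialPrimitive η 0 = 0 := by
  simp [radialPrimitive]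

lemma fderiv_radialPrimitive_zero (hη : ContDiffOn ℝ ∞ η W) (hWo : IsOpen W)
    (hW : StarConvex ℝ 0 W) (h0W : 0 ∈ W) (h0 : η 0 = 0) : fderiv ℝ (radialPrimitive η) 0 = 0 := by
  have hη0 (t : ℝ) : DifferentiableAt ℝ η (t • 0) := by
    rw [smul_zero]
    exact (hη.differentiableOn (by simp)).differentiableAt (hWo.mem_nhds h0W)
  have hintegrand (t : ℝ) : fderiv ℝ (fun y => t ^ n • (η (t • y)).curryLeft y) 0 = 0 := by
    refine (hasFDerivAt_curryLeft_apply (hasFDerivAt_pow_smul_comp_smul (hη0 t))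
      (hasFDerivAt_id (0 : E))).fderiv.trans ?_
    ext
    simp [h0]
  rw [(hasFDerivAt_radialPrimitive hη hWo hW h0W).fderiv]
  simp only [hintegrand, integral_zero]

lemma radialPrimitive_compContinuousLinearMap (hη : ContDiffOn ℝ ∞ η W)
    (hW : StarConvex ℝ 0 W) {A : E →L[ℝ] E}
    (hA : ∀ x ∈ W, (η (A x)).compContinuousLinearMap A = η x) {x : E} (hx : x ∈ W)
    (hAx : A x ∈ W) :
    (radialPrimitive η (A x)).compContinuousLinearMap A = radialPrimitive η x := by
  have hcont : Continuous fun t : Icc (0 : ℝ) 1 =>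
      (t : ℝ) ^ n • (η ((t : ℝ) • A x)).curryLeft (A x) :=
    (contMDiffOn_radialPrimitive_integrand hη hW).continuousOn.comp_continuous
      (f := fun t => (t, A x)) (by fun_prop) fun t => ⟨mem_univ t, hAx⟩
  have hcomm := (compContinuousLinearMapCLM A).integral_comp_comm
    (integrable_continuousMap volume ⟨_, hcont⟩)
  refine hcomm.symm.trans (integral_congr_ae (Eventually.of_forall fun t => ?_))
  have hAt := hA _ (hW.smul_mem hx t.2.1 t.2.2)
  simp [← hAt]

end RadialPrimitive

section InverseFunction

variable {E F : Type*} [NormedAddCommGroup E] [NormedSpace ℝ E] [CompleteSpace E]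
  [NormedAddCommGroup F] [NormedSpace ℝ F]

lemma exists_openPartialHomeomorph_contDiffOn_symm {f : E → F} {W : Set E} {a : E}
    (hW : IsOpen W) (ha : a ∈ W) (hf : ContDiffOn ℝ ∞ f W) (f' : E ≃L[ℝ] F)
    (hf' : HasFDerivAt f (f' : E →L[ℝ] F) a) :
    ∃ P : OpenPartialHomeomorph E F, a ∈ P.source ∧ P.source ⊆ W ∧ ⇑P = f ∧
      ContDiffOn ℝ ∞ P.symm P.target := by
  have hfa : ContDiffAt ℝ ∞ f a := hf.contDiffAt (hW.mem_nhds ha)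
  let P₀ := hfa.toOpenPartialHomeomorph f hf' (by simp)
  let S := W ∩ fderiv ℝ f ⁻¹' range ((↑) : (E ≃L[ℝ] F) → E →L[ℝ] F)
  have hS : IsOpen S := (hf.continuousOn_fderiv_of_isOpen hW (by simp)).isOpen_inter_preimage hW
    ContinuousLinearEquiv.isOpen
  have haS : a ∈ S := ⟨ha, f', hf'.fderiv.symm⟩
  let P := P₀.restrOpen S hS
  refine ⟨P, ⟨hfa.mem_toOpenPartialHomeomorph_source hf' (by simp), haS⟩, fun x hx => hx.2.1, rfl,
    fun y hy => ?_⟩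
  have hx : P.symm y ∈ P.source := P.map_target hy
  obtain ⟨A, hA⟩ := hx.2.2
  have hfx : ContDiffAt ℝ ∞ f (P.symm y) := hf.contDiffAt (hW.mem_nhds hx.2.1)
  have hder : HasFDerivAt f (A : E →L[ℝ] F) (P.symm y) := by
    rw [hA]
    exact (hfx.differentiableAt (by simp)).hasFDerivAt
  exact (P.contDiffAt_symm hy hder hfx).contDiffWithinAt

end InverseFunction

section Representation

variable {Γ E : Type*} [Group Γ] [NormedAddCommGroup E] [NormedSpace ℝ E]

lemma inv_apply_apply (ρ : Γ →* (E →L[ℝ] E)) (g : Γ) (x : E) : ρ g⁻¹ (ρ g x) = x := by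
  rw [← mul_apply_eq_comp, ← map_mul, inv_mul_cancel, map_one, one_apply_eq_self]

lemma exists_isOpen_starConvex_mapsTo {ρ : Γ →* (E →L[ℝ] E)}
    (hρ : BddAbove (range fun g => ‖ρ g‖)) {N : Set E} (hN : N ∈ 𝓝 0) :
    ∃ S ⊆ N, IsOpen S ∧ 0 ∈ S ∧ StarConvex ℝ 0 S ∧ ∀ g, MapsTo (ρ g) S S := by
  obtain ⟨C, hC⟩ := hρ
  obtain ⟨r, hr, hrN⟩ := Metric.mem_nhds_iff.1 hN
  have hC0 : 0 ≤ C := (norm_nonneg _).trans (hC (mem_range_self 1))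
  have hδ : 0 < r / (C + 1) := by positivity
  refine ⟨⋃ g, ρ g ⁻¹' Metric.ball 0 (r / (C + 1)), iUnion_subset fun g x hx => hrN ?_,
    isOpen_iUnion fun g => Metric.isOpen_ball.preimage (ρ g).continuous,
    mem_iUnion.2 ⟨1, by simpa only [mem_preimage, map_zero] using Metric.mem_ball_self hδ⟩,
    starConvex_iUnion fun g => ?_, fun h x hx => ?_⟩
  · rw [mem_preimage, mem_ball_zero_iff, lt_div_iff₀ (by positivity)] at hx
    rw [mem_ball_zero_iff, ← inv_apply_apply ρ g x]
    calc ‖ρ g⁻¹ (ρ g x)‖ ≤ C * ‖ρ g x‖ := (ρ g⁻¹).le_of_opNorm_le (hC (mem_range_self _)) _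
      _ ≤ ‖ρ g x‖ * (C + 1) := by nlinarith [norm_nonneg (ρ g x)]
      _ < r := hx
  · have hball := (convex_ball (0 : E) (r / (C + 1))).starConvex (Metric.mem_ball_self hδ)
    have hpre : StarConvex ℝ (ρ g 0) (Metric.ball 0 (r / (C + 1))) := by rwa [map_zero]
    exact hpre.linear_preimage (ρ g : E →ₗ[ℝ] E)
  · obtain ⟨g, hg⟩ := mem_iUnion.1 hx
    refine mem_iUnion.2 ⟨g * h⁻¹, ?_⟩
    rwa [mem_preimage, map_mul, mul_apply_eq_comp, inv_apply_apply]

/-- A smooth local diffeomorphism at the origin which fixes the origin and commutes with the linear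
action `ρ`. -/
structure IsEquivariantLocalDiffeo (ρ : Γ →* (E →L[ℝ] E)) (f : OpenPartialHomeomorph E E) :
    Prop where
  zero_mem : 0 ∈ f.source
  map_zero : f 0 = 0
  contDiffOn : ContDiffOn ℝ ∞ f f.source
  contDiffOn_symm : ContDiffOn ℝ ∞ f.symm f.target
  mapsTo : ∀ g, MapsTo (ρ g) f.source f.source
  map_apply : ∀ g, ∀ x ∈ f.source, f (ρ g x) = ρ g (f x)

end Representation

section Flow

variable {E : Type u} [NormedAddCommGroup E] [NormedSpace ℝ E]

omit [NormedSpace ℝ E] in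
lemma intervalIntegrable_IccExtend (w : C(Icc (0 : ℝ) 1, E)) (a b : ℝ) :
    IntervalIntegrable (IccExtend (zero_le_one' ℝ) w) volume a b :=
  w.continuous.Icc_extend'.intervalIntegrable a b

/-- The Volterra operator `w ↦ (t ↦ ∫₀ᵗ w)` on `C([0, 1], E)`. -/
def volterra : C(Icc (0 : ℝ) 1, E) →L[ℝ] C(Icc (0 : ℝ) 1, E) :=
  LinearMap.mkContinuous
    { toFun := fun w => ⟨fun t => ∫ s in (0 : ℝ)..t, IccExtend (zero_le_one' ℝ) w s,
        (intervalIntegral.continuous_primitive (intervalIntegrable_IccExtend w) 0).comp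
          continuous_subtype_val⟩
      map_add' := fun w z => ContinuousMap.ext fun t => intervalIntegral.integral_add
        (intervalIntegrable_IccExtend w _ _) (intervalIntegrable_IccExtend z _ _)
      map_smul' := fun c w => ContinuousMap.ext fun t => intervalIntegral.integral_smul c _ }
    1 fun w => by
      rw [one_mul, ContinuousMap.norm_le _ (norm_nonneg w)]
      intro t
      have h := intervalIntegral.norm_integral_le_of_norm_le_const (a := (0 : ℝ)) (b := t)
        (f := IccExtend (zero_le_one' ℝ) w) (C := ‖w‖) fun s _ => w.norm_coe_le_norm _
      refine h.trans (mul_le_of_le_one_right (norm_nonneg w) ?_)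
      rw [sub_zero, abs_of_nonneg t.2.1]
      exact t.2.2

lemma volterra_comp [CompleteSpace E] (A : E →L[ℝ] E) (w : C(Icc (0 : ℝ) 1, E)) :
    volterra ((A : C(E, E)).comp w) = (A : C(E, E)).comp (volterra w) :=
  ContinuousMap.ext fun _ =>
    A.intervalIntegral_comp_comm (intervalIntegrable_IccExtend w _ _)

lemma exists_hasDerivAt_of_eq_const_add_volterra [CompleteSpace E]
    {w z : C(Icc (0 : ℝ) 1, E)} {x : E}
    (h : w = ContinuousLinearMap.const ℝ _ x + volterra z) :
    ∃ c : ℝ → E, c 0 = x ∧ ∀ t : Icc (0 : ℝ) 1, c t = w t ∧ HasDerivAt c (z t) t := by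
  refine ⟨fun t => x + ∫ s in (0 : ℝ)..t, IccExtend (zero_le_one' ℝ) z s, by simp,
    fun t => ⟨by rw [h]; rfl, ?_⟩⟩
  have hderiv := intervalIntegral.integral_hasDerivAt_right (intervalIntegrable_IccExtend z 0 t)
    (z.continuous.Icc_extend'.stronglyMeasurableAtFilter _ _) z.continuous.Icc_extend'.continuousAt
  rw [IccExtend_val] at hderiv
  exact hderiv.const_add x

/-- `U` is the local flow, over the time interval `[0, 1]`, of the time-dependent vector field `X`:
for `x ∈ D` the curve `U x` is the only solution of `w' = X w`, `w 0 = x` with values in `S`. The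
differential equation is written in its integral form. -/
structure IsLocalFlow (X : Icc (0 : ℝ) 1 → E → E) (S D : Set E)
    (U : E → C(Icc (0 : ℝ) 1, E)) : Prop where
  contDiffOn : ContDiffOn ℝ ∞ U D
  mem_mapsInto : ∀ x ∈ D, U x ∈ mapsInto _ S
  eq_add_volterra : ∀ x ∈ D,
    U x = ContinuousLinearMap.const ℝ _ x + volterra (superposition X (U x))
  unique : ∀ x, ∀ w ∈ mapsInto _ S,
    w = ContinuousLinearMap.const ℝ _ x + volterra (superposition X w) → x ∈ D ∧ U x = w

variable {X : Icc (0 : ℝ) 1 → E → E} {W : Set E}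

theorem exists_isLocalFlow [CompleteSpace E] (hWo : IsOpen W) (h0W : 0 ∈ W)
    (hX : ContMDiffOn ((𝓡∂ 1).prod 𝓘(ℝ, E)) 𝓘(ℝ, E) ∞ (uncurry X) (univ ×ˢ W))
    (hX0' : ∀ t, fderiv ℝ (X t) 0 = 0) :
    ∃ M ∈ 𝓝 (0 : E), ∀ S ⊆ M, IsOpen S → ∃ D U, IsOpen D ∧ IsLocalFlow X S D U := by
  have h0W' : (0 : C(Icc (0 : ℝ) 1, E)) ∈ mapsInto _ W := fun _ => h0W
  let R : C(Icc (0 : ℝ) 1, E) → C(Icc (0 : ℝ) 1, E) := fun w => w - volterra (superposition X w)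
  have hR : ContDiffOn ℝ ∞ R (mapsInto _ W) := by
    have hVX : ContDiffOn ℝ ∞ (volterra ∘ superposition X) (mapsInto _ W) :=
      (volterra (E := E)).contDiff.comp_contDiffOn (contDiffOn_superposition hWo hX)
    exact contDiffOn_id.sub hVX
  have hR' : HasFDerivAt R (ContinuousLinearEquiv.refl ℝ C(Icc (0 : ℝ) 1, E) :
      C(Icc (0 : ℝ) 1, E) →L[ℝ] C(Icc (0 : ℝ) 1, E)) 0 := by
    refine ((hasFDerivAt_id 0).sub (volterra.hasFDerivAt.comp 0
      (hasFDerivAt_superposition_of_contMDiffOn hWo hX h0W'))).congr_fderiv ?_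
    rw [superposition_zero hX0', map_zero, ContinuousLinearMap.comp_zero, sub_zero]
    rfl
  obtain ⟨P, h0P, -, hPR, hPs⟩ := exists_openPartialHomeomorph_contDiffOn_symm
    (isOpen_mapsInto hWo) h0W' hR _ hR'
  obtain ⟨M, hM, hMP⟩ := exists_mapsInto_subset (P.open_source.mem_nhds h0P)
  refine ⟨M, hM, fun S hSM hSo => ?_⟩
  let PS := P.restrOpen (mapsInto _ S) (isOpen_mapsInto hSo)
  have hPSR : ∀ w, PS w = w - volterra (superposition X w) := fun w => congrFun hPR w
  refine ⟨ContinuousLinearMap.const ℝ _ ⁻¹' PS.target,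
    fun x => PS.symm (ContinuousLinearMap.const ℝ _ x),
    PS.open_target.preimage (ContinuousLinearMap.const ℝ _).continuous, ?_, fun x hx => ?_,
    fun x hx => ?_, fun x w hw hwx => ?_⟩
  · have hconst : ContDiff ℝ ∞ (ContinuousLinearMap.const ℝ (Icc (0 : ℝ) 1) (M := E)) :=
      ContinuousLinearMap.contDiff _
    exact (hPs.mono fun z hz => hz.1).comp hconst.contDiffOn (mapsTo_preimage _ _)
  · exact (PS.map_target hx).2
  · rw [← sub_eq_iff_eq_add, ← hPSR]
    exact PS.right_inv hx
  · have hwPS : w ∈ PS.source := ⟨hMP fun t => hSM (hw t), hw⟩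
    have hPw : PS w = ContinuousLinearMap.const ℝ _ x := by rw [hPSR, sub_eq_iff_eq_add, ← hwx]
    exact ⟨by rw [mem_preimage, ← hPw]; exact PS.map_source hwPS,
      by rw [← hPw]; exact PS.left_inv hwPS⟩

namespace IsLocalFlow

variable {S D : Set E} {U : E → C(Icc (0 : ℝ) 1, E)} (hU : IsLocalFlow X S D U)
include hU

lemma zero_mem_and_map_zero (h0S : 0 ∈ S) (hX0 : ∀ t, X t 0 = 0) : 0 ∈ D ∧ U 0 = 0 := by
  refine hU.unique 0 0 (fun _ => h0S) ?_
  rw [superposition_zero hX0, map_zero, map_zero, add_zero]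

lemma equivariant [CompleteSpace E] (hSW : S ⊆ W) (hX : ContinuousOn (uncurry X) (univ ×ˢ W))
    {A : E →L[ℝ] E} (hAS : MapsTo A S S) (hXA : ∀ t, ∀ x ∈ S, X t (A x) = A (X t x)) {x : E}
    (hx : x ∈ D) : A x ∈ D ∧ U (A x) = (A : C(E, E)).comp (U x) := by
  have hS := hU.mem_mapsInto x hx
  refine hU.unique _ _ (fun t => hAS (hS t)) ?_
  have hsup : superposition X ((A : C(E, E)).comp (U x)) =
      (A : C(E, E)).comp (superposition X (U x)) := by
    ext t : 1
    rw [superposition_apply hX fun t => hSW (hAS (hS t))]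
    refine (hXA t _ (hS t)).trans ?_
    rw [← superposition_apply hX fun t => hSW (hS t)]
    rfl
  rw [hsup, volterra_comp]
  ext t : 1
  exact (congrArg A (DFunLike.congr_fun (hU.eq_add_volterra x hx) t)).trans (map_add A _ _)

lemma fderiv_apply_eq_add_volterra (hDo : IsOpen D) (hWo : IsOpen W) (hSW : S ⊆ W)
    (hX : ContMDiffOn ((𝓡∂ 1).prod 𝓘(ℝ, E)) 𝓘(ℝ, E) ∞ (uncurry X) (univ ×ˢ W)) {x : E}
    (hx : x ∈ D) (v : E) :
    fderiv ℝ U x v = ContinuousLinearMap.const ℝ _ v + volterra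
      (pointwiseApply (superposition (fun t x => fderiv ℝ (X t) x) (U x)) (fderiv ℝ U x v)) := by
  have hDx := hDo.mem_nhds hx
  have hUx : HasFDerivAt U (fderiv ℝ U x) x :=
    ((hU.contDiffOn.contDiffAt hDx).differentiableAt (by simp)).hasFDerivAt
  have hXU := hasFDerivAt_superposition_of_contMDiffOn hWo hX
    fun t => hSW (hU.mem_mapsInto x hx t)
  have hder : HasFDerivAt U _ x := ((ContinuousLinearMap.const ℝ _).hasFDerivAt.add
    ((volterra (E := E)).hasFDerivAt.comp x (hXU.comp x hUx))).congr_of_eventuallyEq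
      (eventually_of_mem hDx hU.eq_add_volterra)
  exact DFunLike.congr_fun (hUx.unique hder) v

lemma fderiv_zero (hDo : IsOpen D) (hWo : IsOpen W) (hSW : S ⊆ W)
    (hX : ContMDiffOn ((𝓡∂ 1).prod 𝓘(ℝ, E)) 𝓘(ℝ, E) ∞ (uncurry X) (univ ×ˢ W)) (h0S : 0 ∈ S)
    (hX0 : ∀ t, X t 0 = 0) (hX0' : ∀ t, fderiv ℝ (X t) 0 = 0) :
    fderiv ℝ U 0 = ContinuousLinearMap.const ℝ _ := by
  obtain ⟨h0D, hU0⟩ := hU.zero_mem_and_map_zero h0S hX0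
  ext v : 1
  rw [hU.fderiv_apply_eq_add_volterra hDo hWo hSW hX h0D, hU0,
    superposition_zero hX0', map_zero, zero_apply, map_zero, add_zero]

variable [CompleteSpace E]

lemma exists_hasDerivAt (hSW : S ⊆ W) (hX : ContinuousOn (uncurry X) (univ ×ˢ W)) {x : E}
    (hx : x ∈ D) :
    ∃ c : ℝ → E, c 0 = x ∧ ∀ t : Icc (0 : ℝ) 1, c t = U x t ∧ HasDerivAt c (X t (c t)) t := by
  obtain ⟨c, hc0, hc⟩ := exists_hasDerivAt_of_eq_const_add_volterra (hU.eq_add_volterra x hx)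
  refine ⟨c, hc0, fun t => ⟨(hc t).1, ?_⟩⟩
  rw [(hc t).1, ← superposition_apply hX fun t => hSW (hU.mem_mapsInto x hx t)]
  exact (hc t).2

lemma exists_hasDerivAt_fderiv_apply (hDo : IsOpen D) (hWo : IsOpen W) (hSW : S ⊆ W)
    (hX : ContMDiffOn ((𝓡∂ 1).prod 𝓘(ℝ, E)) 𝓘(ℝ, E) ∞ (uncurry X) (univ ×ˢ W)) {x : E}
    (hx : x ∈ D) (v : E) :
    ∃ a : ℝ → E, a 0 = v ∧ ∀ t : Icc (0 : ℝ) 1, a t = fderiv ℝ U x v t ∧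
      HasDerivAt a (fderiv ℝ (X t) (U x t) (a t)) t := by
  obtain ⟨a, ha0, ha⟩ := exists_hasDerivAt_of_eq_const_add_volterra
    (hU.fderiv_apply_eq_add_volterra hDo hWo hSW hX hx v)
  refine ⟨a, ha0, fun t => ⟨(ha t).1, (ha t).2.congr_deriv ?_⟩⟩
  rw [(ha t).1, pointwiseApply_apply, superposition_apply
    (contMDiffOn_fderiv_snd hWo hX).continuousOn fun t => hSW (hU.mem_mapsInto x hx t)]

lemma exists_openPartialHomeomorph_eval_one (hDo : IsOpen D) (hWo : IsOpen W) (hSW : S ⊆ W)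
    (hX : ContMDiffOn ((𝓡∂ 1).prod 𝓘(ℝ, E)) 𝓘(ℝ, E) ∞ (uncurry X) (univ ×ˢ W)) (h0S : 0 ∈ S)
    (hX0 : ∀ t, X t 0 = 0) (hX0' : ∀ t, fderiv ℝ (X t) 0 = 0) :
    ∃ P : OpenPartialHomeomorph E E, 0 ∈ P.source ∧ P.source ⊆ D ∧ (∀ x, P x = U x 1) ∧
      ContDiffOn ℝ ∞ P P.source ∧ ContDiffOn ℝ ∞ P.symm P.target ∧
      ∀ x ∈ D, ∀ v, fderiv ℝ P x v = fderiv ℝ U x v 1 := by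
  obtain ⟨h0D, -⟩ := hU.zero_mem_and_map_zero h0S hX0
  let ev : C(Icc (0 : ℝ) 1, E) →L[ℝ] E := ContinuousMap.evalCLM ℝ 1
  have hφ : ContDiffOn ℝ ∞ (ev ∘ U) D := ev.contDiff.comp_contDiffOn hU.contDiffOn
  have hφ' : ∀ x ∈ D, HasFDerivAt (ev ∘ U) (ev ∘L fderiv ℝ U x) x := fun x hx =>
    ev.hasFDerivAt.comp x
      ((hU.contDiffOn.contDiffAt (hDo.mem_nhds hx)).differentiableAt (by simp)).hasFDerivAt
  have hφ0 : HasFDerivAt (ev ∘ U) (ContinuousLinearEquiv.refl ℝ E : E →L[ℝ] E) 0 := by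
    refine (hφ' 0 h0D).congr_fderiv ?_
    rw [hU.fderiv_zero hDo hWo hSW hX h0S hX0 hX0']
    rfl
  obtain ⟨P, h0P, hPD, hPφ, hPs⟩ := exists_openPartialHomeomorph_contDiffOn_symm hDo h0D hφ _ hφ0
  refine ⟨P, h0P, hPD, congrFun hPφ, (hPφ ▸ hφ).mono hPD, hPs, fun x hx v => ?_⟩
  rw [hPφ, (hφ' x hx).fderiv]
  rfl

end IsLocalFlow

theorem exists_equivariant_timeOneMap [CompleteSpace E] {Γ : Type*} [Group Γ]
    {ρ : Γ →* (E →L[ℝ] E)} (hρ : BddAbove (range fun g => ‖ρ g‖)) (hWo : IsOpen W) (h0W : 0 ∈ W)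
    (hX : ContMDiffOn ((𝓡∂ 1).prod 𝓘(ℝ, E)) 𝓘(ℝ, E) ∞ (uncurry X) (univ ×ˢ W))
    (hX0 : ∀ t, X t 0 = 0) (hX0' : ∀ t, fderiv ℝ (X t) 0 = 0)
    (hXρ : ∀ g t, ∀ x ∈ W, X t (ρ g x) = ρ g (X t x)) :
    ∃ f : OpenPartialHomeomorph E E, IsEquivariantLocalDiffeo ρ f ∧ ∀ x ∈ f.source,
      ∃ c : ℝ → E, c 0 = x ∧ c 1 = f x ∧
        (∀ t : Icc (0 : ℝ) 1, c t ∈ W ∧ HasDerivAt c (X t (c t)) t) ∧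
        ∀ v, ∃ a : ℝ → E, a 0 = v ∧ a 1 = fderiv ℝ f x v ∧
          ∀ t : Icc (0 : ℝ) 1, HasDerivAt a (fderiv ℝ (X t) (c t) (a t)) t := by
  obtain ⟨M, hM, hflow⟩ := exists_isLocalFlow hWo h0W hX hX0'
  obtain ⟨S, hS, hSo, h0S, -, hρS⟩ :=
    exists_isOpen_starConvex_mapsTo hρ (inter_mem hM (hWo.mem_nhds h0W))
  have hSW : S ⊆ W := fun x hx => (hS hx).2
  obtain ⟨D, U, hDo, hU⟩ := hflow S (fun x hx => (hS hx).1) hSo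
  obtain ⟨P, h0P, hPD, hPU, hP, hPs, hPU'⟩ :=
    hU.exists_openPartialHomeomorph_eval_one hDo hWo hSW hX h0S hX0 hX0'
  obtain ⟨T, hTP, hTo, h0T, -, hρT⟩ :=
    exists_isOpen_starConvex_mapsTo hρ (P.open_source.mem_nhds h0P)
  refine ⟨P.restrOpen T hTo, ⟨⟨h0P, h0T⟩, ?_, hP.mono fun x hx => hx.1, hPs.mono fun y hy => hy.1,
    fun g x hx => ⟨hTP (hρT g hx.2), hρT g hx.2⟩, fun g x hx => ?_⟩, fun x hx => ?_⟩
  · refine (hPU 0).trans ?_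
    rw [(hU.zero_mem_and_map_zero h0S hX0).2]
    rfl
  · refine (hPU _).trans ?_
    rw [(hU.equivariant hSW hX.continuousOn (hρS g) (fun t x hx => hXρ g t x (hSW hx))
      (hPD hx.1)).2]
    exact congrArg (ρ g) (hPU x).symm
  · obtain ⟨c, hc0, hc⟩ := hU.exists_hasDerivAt hSW hX.continuousOn (hPD hx.1)
    refine ⟨c, hc0, (hc 1).1.trans (hPU x).symm, fun t => ⟨?_, (hc t).2⟩, fun v => ?_⟩
    · rw [(hc t).1]
      exact hSW (hU.mem_mapsInto x (hPD hx.1) t)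
    · obtain ⟨a, ha0, ha⟩ := hU.exists_hasDerivAt_fderiv_apply hDo hWo hSW hX (hPD hx.1) v
      exact ⟨a, ha0, (ha 1).1.trans (hPU' x (hPD hx.1) v).symm, fun t => (hc t).1 ▸ (ha t).2⟩

end Flow

section MoserPath

open ContinuousAlternatingMap

variable {E F : Type*} [NormedAddCommGroup E] [NormedSpace ℝ E] [NormedAddCommGroup F]
  [NormedSpace ℝ F] {n : ℕ}

lemma hasDerivAt_continuousAlternatingMap_apply {σ : ℝ → E [⋀^Fin n]→L[ℝ] F}
    {σ' : E [⋀^Fin n]→L[ℝ] F} {a : Fin n → ℝ → E} {L : E →L[ℝ] E} {t : ℝ}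
    (hσ : HasDerivAt σ σ' t) (ha : ∀ i, HasDerivAt (a i) (L (a i t)) t) :
    HasDerivAt (fun s => σ s (a · s))
      ((σ' + (σ t).fderivCompContinuousLinearMap (.id ℝ E) L) (a · t)) t := by
  refine ((hσ.hasFDerivAt.continuousAlternatingMap_apply
    fun i => (ha i).hasFDerivAt).hasDerivAt).congr_deriv ?_
  simp only [_root_.add_apply, ContinuousLinearMap.comp_apply, one_smul, apply_apply,
    ContinuousLinearMap.toSpanSingleton_apply, _root_.sum_apply, toContinuousLinearMap_apply,
    ContinuousAlternatingMap.add_apply, fderivCompContinuousLinearMap_apply, add_right_inj]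
  refine Finset.sum_congr rfl fun i _ => congrArg (σ t) (funext fun j => ?_)
  obtain rfl | hji := eq_or_ne j i
  · simp
  · simp [hji]

/-- The segment from the form `η` to the constant form `η 0`. -/
def moserPath (η : E → E [⋀^Fin n]→L[ℝ] F) (t : ℝ) (x : E) : E [⋀^Fin n]→L[ℝ] F :=
  η x + t • (η 0 - η x)

variable {W : Set E}

lemma moserPath_apply_zero (η : E → E [⋀^Fin n]→L[ℝ] F) (t : ℝ) : moserPath η t 0 = η 0 := by
  rw [moserPath, sub_self, smul_zero, add_zero]

lemma moserPath_zero (η : E → E [⋀^Fin n]→L[ℝ] F) : moserPath η 0 = η := by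
  ext
  simp [moserPath]

lemma moserPath_one (η : E → E [⋀^Fin n]→L[ℝ] F) : moserPath η 1 = fun _ => η 0 := by
  ext
  simp [moserPath]

lemma contDiffOn_moserPath {η : E → E [⋀^Fin n]→L[ℝ] F} (hη : ContDiffOn ℝ ∞ η W) :
    ContDiffOn ℝ ∞ (uncurry (moserPath η)) (univ ×ˢ W) := by
  have hsnd : ContDiffOn ℝ ∞ (fun p : ℝ × E => η p.2) (univ ×ˢ W) :=
    hη.comp contDiffOn_snd fun p hp => hp.2
  exact hsnd.add (contDiffOn_fst.smul (contDiffOn_const.sub hsnd))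

lemma hasFDerivAt_moserPath {η : E → E [⋀^Fin n]→L[ℝ] F} {x : E} (hη : DifferentiableAt ℝ η x)
    (t : ℝ) : HasFDerivAt (moserPath η t) ((1 - t) • fderiv ℝ η x) x := by
  have hder := hη.hasFDerivAt.add ((hη.hasFDerivAt.const_sub (η 0)).const_smul t)
  refine hder.congr_fderiv ?_
  rw [smul_neg, sub_smul, one_smul, sub_eq_add_neg]

lemma extDeriv_moserPath {η : E → E [⋀^Fin n]→L[ℝ] F} {x : E} (hη : DifferentiableAt ℝ η x)
    (hclosed : extDeriv η x = 0) (t : ℝ) : extDeriv (moserPath η t) x = 0 := by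
  rw [extDeriv, (hasFDerivAt_moserPath hη t).fderiv, alternatizeUncurryFin_smul, ← extDeriv,
    hclosed, smul_zero]

lemma hasDerivAt_moserPath_comp {η : E → E [⋀^Fin n]→L[ℝ] F} {c : ℝ → E} {c' : E} {t : ℝ}
    (hη : DifferentiableAt ℝ η (c t)) (hc : HasDerivAt c c' t) :
    HasDerivAt (fun s => moserPath η s (c s))
      (η 0 - η (c t) + fderiv ℝ (moserPath η t) (c t) c') t := by
  have hηc := hη.hasFDerivAt.comp_hasDerivAt t hc
  refine (hηc.add ((hasDerivAt_id t).smul (hηc.const_sub (η 0)))).congr_deriv ?_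
  rw [(hasFDerivAt_moserPath hη t).fderiv, FunLike.coe_smul, Pi.smul_apply, id_eq,
    Function.comp_apply]
  module

lemma moserPath_compContinuousLinearMap {η : E → E [⋀^Fin n]→L[ℝ] F} {A : E →L[ℝ] E} {x : E}
    (h0 : (η 0).compContinuousLinearMap A = η 0)
    (hx : (η (A x)).compContinuousLinearMap A = η x) (t : ℝ) :
    (moserPath η t (A x)).compContinuousLinearMap A = moserPath η t x := by
  rw [moserPath, moserPath, ← hx]
  nth_rw 2 [← h0]
  rfl

lemma eventually_isInvertible_moserPath [CompleteSpace E] {η : E → E [⋀^Fin (n + 1)]→L[ℝ] F}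
    (hη : ContinuousAt η 0) (h0 : (curryLeftCLM ℝ E F n (η 0)).IsInvertible) :
    ∀ᶠ x in 𝓝 0, ∀ t ∈ Icc (0 : ℝ) 1, (curryLeftCLM ℝ E F n (moserPath η t x)).IsInvertible := by
  refine isCompact_Icc.eventually_forall_of_forall_eventually fun t _ => ?_
  have hfst : ContinuousAt (fun z : E × ℝ => η z.1) (0, t) := ContinuousAt.comp (g := η) hη
    continuousAt_fst
  have hpath : ContinuousAt (fun z : E × ℝ => curryLeftCLM ℝ E F n (moserPath η z.2 z.1)) (0, t) :=
    (curryLeftCLM ℝ E F n).continuous.continuousAt.comp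
      (hfst.add (continuousAt_snd.smul (continuousAt_const.sub hfst)))
  refine hpath.eventually_mem (ContinuousLinearEquiv.isOpen.mem_nhds ?_)
  rwa [moserPath_apply_zero]

end MoserPath

section MoserField

open ContinuousAlternatingMap

variable {E : Type u} [NormedAddCommGroup E] [NormedSpace ℝ E] {n : ℕ}

/-- Moser's time-dependent vector field `X`, determined by `ι_X η_t = α`, where `η_t` is the segment
from `η` to `η 0` and `dα = η - η 0`. It is meaningful only where `v ↦ ι_v η_t` is invertible. -/
def moserField (η : E → E [⋀^Fin (n + 1)]→L[ℝ] ℝ) (t : ℝ) (x : E) : E :=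
  (curryLeftCLM ℝ E ℝ n (moserPath η t x)).inverse (radialPrimitive (fun y => η y - η 0) x)

variable {η : E → E [⋀^Fin (n + 1)]→L[ℝ] ℝ} {W : Set E}

lemma curryLeft_moserField {t : ℝ} {x : E}
    (hinv : (curryLeftCLM ℝ E ℝ n (moserPath η t x)).IsInvertible) :
    (moserPath η t x).curryLeft (moserField η t x) = radialPrimitive (fun y => η y - η 0) x :=
  hinv.self_apply_inverse _

lemma moserField_zero (t : ℝ) : moserField η t 0 = 0 := by
  rw [moserField, radialPrimitive_zero, _root_.map_zero]

variable [CompleteSpace E]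

lemma contDiffOn_moserField (hη : ContDiffOn ℝ ∞ η W) (hWo : IsOpen W) (hW : StarConvex ℝ 0 W)
    (hinv : ∀ x ∈ W, ∀ t ∈ Icc (0 : ℝ) 1,
      (curryLeftCLM ℝ E ℝ n (moserPath η t x)).IsInvertible) :
    ContDiffOn ℝ ∞ (uncurry (moserField η)) (Icc (0 : ℝ) 1 ×ˢ W) := by
  have hα : ContDiffOn ℝ ∞ (fun p : ℝ × E => radialPrimitive (fun y => η y - η 0) p.2)
      (Icc (0 : ℝ) 1 ×ˢ W) :=
    (contDiffOn_radialPrimitive (hη.sub contDiffOn_const) hWo hW).comp contDiffOn_snd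
      fun p hp => hp.2
  have hpath := (curryLeftCLM ℝ E ℝ n).contDiff.comp_contDiffOn
    ((contDiffOn_moserPath hη).mono (prod_mono_left (subset_univ (Icc (0 : ℝ) 1))))
  refine ContDiffOn.clm_apply (fun p hp => ?_) hα
  exact ((hinv p.2 hp.2 p.1 hp.1).contDiffAt_map_inverse).comp_contDiffWithinAt p (hpath p hp)

lemma fderiv_moserField_zero (hη : ContDiffOn ℝ ∞ η W) (hWo : IsOpen W) (hW : StarConvex ℝ 0 W)
    (h0W : 0 ∈ W) (h0 : (curryLeftCLM ℝ E ℝ n (η 0)).IsInvertible) (t : ℝ) :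
    fderiv ℝ (moserField η t) 0 = 0 := by
  have hη' : ContDiffOn ℝ ∞ (fun y => η y - η 0) W := hη.sub contDiffOn_const
  have hα : HasFDerivAt (radialPrimitive fun y => η y - η 0)
      (0 : E →L[ℝ] E [⋀^Fin n]→L[ℝ] ℝ) 0 := by
    rw [← fderiv_radialPrimitive_zero hη' hWo hW h0W (sub_self _)]
    exact (((contDiffOn_radialPrimitive hη' hWo hW).contDiffAt
      (hWo.mem_nhds h0W)).differentiableAt (by simp)).hasFDerivAt
  have hpath : ContDiffAt ℝ ∞ (moserPath η t) 0 := by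
    have hη0 : ContDiffAt ℝ ∞ η 0 := hη.contDiffAt (hWo.mem_nhds h0W)
    exact hη0.add ((contDiffAt_const.sub hη0).const_smul t)
  have hinverse : ContDiffAt ℝ ∞ (fun x => (curryLeftCLM ℝ E ℝ n (moserPath η t x)).inverse) 0 := by
    rw [← moserPath_apply_zero η t] at h0
    exact h0.contDiffAt_map_inverse.comp 0
      ((curryLeftCLM ℝ E ℝ n).contDiff.contDiffAt.comp 0 hpath)
  have hder := ((hinverse.differentiableAt (by simp)).hasFDerivAt.clm_apply hα).fderiv
  refine hder.trans ?_
  rw [radialPrimitive_zero, _root_.map_zero, ContinuousLinearMap.comp_zero, add_zero]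

omit [CompleteSpace E] in
lemma moserField_map (hη : ContDiffOn ℝ ∞ η W) (hW : StarConvex ℝ 0 W) (h0W : 0 ∈ W)
    {A : E →L[ℝ] E} (hA : Surjective A) (hAW : MapsTo A W W)
    (hηA : ∀ x ∈ W, (η (A x)).compContinuousLinearMap A = η x) {t : ℝ} {x : E} (hx : x ∈ W)
    (hinvx : (curryLeftCLM ℝ E ℝ n (moserPath η t x)).IsInvertible)
    (hinvA : (curryLeftCLM ℝ E ℝ n (moserPath η t (A x))).IsInvertible) :
    moserField η t (A x) = A (moserField η t x) := by
  have hη0 : (η 0).compContinuousLinearMap A = η 0 := by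
    simpa only [_root_.map_zero] using hηA 0 h0W
  have hη' : ∀ y ∈ W, (η (A y) - η 0).compContinuousLinearMap A = η y - η 0 := fun y hy => by
    nth_rw 2 [← hη0]
    rw [← hηA y hy]
    rfl
  have hα := radialPrimitive_compContinuousLinearMap (η := fun y => η y - η 0)
    (hη.sub contDiffOn_const) hW hη' hx (hAW hx)
  refine (hinvA.inverse_apply_eq).2 ?_
  have hcomp : Injective fun θ : E [⋀^Fin n]→L[ℝ] ℝ => θ.compContinuousLinearMap A :=
    fun θ θ' h => ContinuousAlternatingMap.ext fun v => by
      obtain ⟨w, rfl⟩ := hA.comp_left v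
      exact DFunLike.congr_fun h w
  refine hcomp ?_
  calc _ = (moserPath η t x).curryLeft (moserField η t x) :=
        hα.trans (curryLeft_moserField hinvx).symm
    _ = _ := by
      rw [← moserPath_compContinuousLinearMap hη0 (hηA x hx) t]
      exact curryLeft_compContinuousLinearMap _ _ _

lemma fderiv_moserPath_apply_moserField_add (hη : ContDiffOn ℝ ∞ η W) (hWo : IsOpen W)
    (hW : StarConvex ℝ 0 W) (hclosed : ∀ x ∈ W, extDeriv η x = 0)
    (hinv : ∀ x ∈ W, ∀ t ∈ Icc (0 : ℝ) 1,
      (curryLeftCLM ℝ E ℝ n (moserPath η t x)).IsInvertible) {t : ℝ} (ht : t ∈ Icc (0 : ℝ) 1)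
    {x : E} (hx : x ∈ W) :
    fderiv ℝ (moserPath η t) x (moserField η t x) + (moserPath η t x).fderivCompContinuousLinearMap
      (.id ℝ E) (fderiv ℝ (moserField η t) x) = η x - η 0 := by
  have hWx := hWo.mem_nhds hx
  have hηW : ∀ y ∈ W, DifferentiableAt ℝ η y := fun y hy =>
    (hη.contDiffAt (hWo.mem_nhds hy)).differentiableAt (by simp)
  have hpath := (hasFDerivAt_moserPath (hηW x hx) t).differentiableAt
  have hX : DifferentiableAt ℝ (moserField η t) x := by
    have hXt : ContDiffOn ℝ ∞ (uncurry (moserField η) ∘ Prod.mk t) W :=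
      (contDiffOn_moserField hη hWo hW hinv).comp
        (contDiff_prodMk_right t).contDiffOn fun y hy => ⟨ht, hy⟩
    exact (hXt.contDiffAt hWx).differentiableAt (by simp)
  have hη'closed : ∀ y ∈ W, extDeriv (fun y => η y - η 0) y = 0 := fun y hy => by
    rw [extDeriv, fderiv_sub_const]
    exact hclosed y hy
  have hι : (fun y => (moserPath η t y).curryLeft (moserField η t y)) =ᶠ[𝓝 x]
      radialPrimitive fun y => η y - η 0 :=
    eventually_of_mem hWx fun y hy => curryLeft_moserField (hinv y hy t ht)
  rw [← extDeriv_curryLeft_add_curryLeft_extDeriv hpath hX, hι.extDeriv_eq,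
    extDeriv_moserPath (hηW x hx) (hclosed x hx), curryLeft_zero, _root_.zero_apply, add_zero,
    extDeriv_radialPrimitive (hη.sub contDiffOn_const) hWo hW hη'closed hx]

lemma apply_zero_of_hasDerivAt_moserField (hη : ContDiffOn ℝ ∞ η W) (hWo : IsOpen W)
    (hW : StarConvex ℝ 0 W) (hclosed : ∀ x ∈ W, extDeriv η x = 0)
    (hinv : ∀ x ∈ W, ∀ t ∈ Icc (0 : ℝ) 1,
      (curryLeftCLM ℝ E ℝ n (moserPath η t x)).IsInvertible)
    {c : ℝ → E} {a : Fin (n + 1) → ℝ → E}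
    (hc : ∀ t ∈ Icc (0 : ℝ) 1, c t ∈ W ∧ HasDerivAt c (moserField η t (c t)) t)
    (ha : ∀ i, ∀ t ∈ Icc (0 : ℝ) 1,
      HasDerivAt (a i) (fderiv ℝ (moserField η t) (c t) (a i t)) t) :
    η 0 (a · 1) = η (c 0) (a · 0) := by
  have hconst (t : ℝ) (ht : t ∈ Icc (0 : ℝ) 1) :
      HasDerivAt (fun s => moserPath η s (c s) (a · s)) 0 t := by
    obtain ⟨hcW, hct⟩ := hc t ht
    have hσ := hasDerivAt_moserPath_comp
      ((hη.contDiffAt (hWo.mem_nhds hcW)).differentiableAt (by simp)) hct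
    refine (hasDerivAt_continuousAlternatingMap_apply hσ fun i => ha i t ht).congr_deriv ?_
    rw [add_assoc, fderiv_moserPath_apply_moserField_add hη hWo hW hclosed hinv ht hcW]
    simp
  have hends := integral_Icc_eq_sub_of_hasDerivAt hconst continuousOn_const
  rw [integral_zero, eq_comm, sub_eq_zero] at hends
  simpa only [moserPath_one, moserPath_zero] using hends

theorem exists_isEquivariantLocalDiffeo_pullback_eq {Γ : Type*} [Group Γ]
    {ρ : Γ →* (E →L[ℝ] E)} (hρ : BddAbove (range fun g => ‖ρ g‖)) (hWo : IsOpen W) (h0W : 0 ∈ W)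
    (hη : ContDiffOn ℝ ∞ η W) (hclosed : ∀ x ∈ W, extDeriv η x = 0)
    (h0 : (curryLeftCLM ℝ E ℝ n (η 0)).IsInvertible)
    (hηρ : ∀ g, ∀ x ∈ W, ρ g x ∈ W → (η (ρ g x)).compContinuousLinearMap (ρ g) = η x) :
    ∃ f : OpenPartialHomeomorph E E, IsEquivariantLocalDiffeo ρ f ∧ f.source ⊆ W ∧
      ∀ x ∈ f.source, (η 0).compContinuousLinearMap (fderiv ℝ f x) = η x := by
  have hinv := eventually_isInvertible_moserPath
    (hη.continuousOn.continuousAt (hWo.mem_nhds h0W)) h0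
  obtain ⟨S, hS, hSo, h0S, hSstar, hρS⟩ :=
    exists_isOpen_starConvex_mapsTo hρ (inter_mem (hWo.mem_nhds h0W) hinv)
  have hSW : S ⊆ W := fun x hx => (hS hx).1
  have hinvS : ∀ x ∈ S, ∀ t ∈ Icc (0 : ℝ) 1,
      (curryLeftCLM ℝ E ℝ n (moserPath η t x)).IsInvertible := fun x hx => (hS hx).2
  have hηS := hη.mono hSW
  have hclosedS : ∀ x ∈ S, extDeriv η x = 0 := fun x hx => hclosed x (hSW hx)
  have hηρS : ∀ g, ∀ x ∈ S, (η (ρ g x)).compContinuousLinearMap (ρ g) = η x :=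
    fun g x hx => hηρ g x (hSW hx) (hSW (hρS g hx))
  have hρsurj : ∀ g, Surjective (ρ g) := fun g x => ⟨ρ g⁻¹ x, by
    simpa only [inv_inv] using inv_apply_apply ρ g⁻¹ x⟩
  obtain ⟨f, hf, hflow⟩ := exists_equivariant_timeOneMap (X := fun t => moserField η t) hρ hSo h0S
    (contMDiffOn_uncurry_Icc (contDiffOn_moserField hηS hSo hSstar hinvS))
    (fun t => moserField_zero _) (fun t => fderiv_moserField_zero hηS hSo hSstar h0S h0 t)
    fun g t x hx => moserField_map hηS hSstar h0S (hρsurj g) (hρS g) (hηρS g) hx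
      (hinvS x hx t t.2) (hinvS _ (hρS g hx) t t.2)
  refine ⟨f, hf, fun x hx => ?_, fun x hx => ContinuousAlternatingMap.ext fun v => ?_⟩
  · obtain ⟨c, hc0, -, hc, -⟩ := hflow x hx
    exact hSW (hc0 ▸ (hc 0).1)
  · obtain ⟨c, hc0, -, hc, ha⟩ := hflow x hx
    choose a ha0 ha1 ha using ha
    have hends := apply_zero_of_hasDerivAt_moserField hηS hSo hSstar hclosedS hinvS
      (fun t ht => hc ⟨t, ht⟩) fun i t ht => ha (v i) ⟨t, ht⟩
    simpa only [hc0, ha0, ha1] using! hends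

end MoserField

section InvariantCore

variable {Q Γ : Type*} [Group Γ] [MulAction Γ Q]

/-- The largest `Γ`-invariant subset of `S`. -/
def invariantCore (Γ : Type*) [Group Γ] [MulAction Γ Q] (S : Set Q) : Set Q :=
  {x | ∀ g : Γ, g • x ∈ S}

lemma invariantCore_subset (S : Set Q) : invariantCore Γ S ⊆ S := fun x hx => by
  simpa only [one_smul] using hx 1

lemma smul_mem_invariantCore {S : Set Q} {x : Q} (hx : x ∈ invariantCore Γ S) (g : Γ) :
    g • x ∈ invariantCore Γ S := fun h => by
  rw [← mul_smul]
  exact hx (h * g)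

lemma mem_invariantCore_of_fixed {S : Set Q} {q : Q} (hq : ∀ g : Γ, g • q = q) (hqS : q ∈ S) :
    q ∈ invariantCore Γ S := fun g => (hq g).symm ▸ hqS

lemma isOpen_invariantCore [TopologicalSpace Q] [TopologicalSpace Γ] [CompactSpace Γ]
    [ContinuousSMul Γ Q] {S : Set Q} (hS : IsOpen S) : IsOpen (invariantCore Γ S) := by
  have hclosed : IsClosed ((fun p : Γ × Q => p.1 • p.2) ⁻¹' Sᶜ) :=
    hS.isClosed_compl.preimage continuous_smul
  rw [← isClosed_compl_iff]
  convert isClosedMap_snd_of_compactSpace _ hclosed using 1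
  ext x
  simp [invariantCore]

variable [TopologicalSpace Q] {X : Type*} [TopologicalSpace X] (e : OpenPartialHomeomorph Q X)

variable (Γ) in
/-- The image under the chart `e` of the largest invariant subset of its domain. -/
def invariantTarget : Set X :=
  e.target ∩ e.symm ⁻¹' invariantCore Γ e.source

lemma isOpen_invariantTarget [TopologicalSpace Γ] [CompactSpace Γ] [ContinuousSMul Γ Q] :
    IsOpen (invariantTarget Γ e) :=
  e.isOpen_inter_preimage_symm (isOpen_invariantCore e.open_source)

variable {e} in
lemma map_mem_invariantTarget {x : Q} (hx : x ∈ invariantCore Γ e.source) :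
    e x ∈ invariantTarget Γ e :=
  ⟨e.map_source (invariantCore_subset _ hx),
    by rwa [mem_preimage, e.left_inv (invariantCore_subset _ hx)]⟩

end InvariantCore

section Isotropy

variable {E : Type*} [NormedAddCommGroup E] [NormedSpace ℝ E]
  {Q : Type*} [TopologicalSpace Q] [ChartedSpace E Q] {Γ : Type*} [Group Γ] [MulAction Γ Q]

lemma tangentCast_apply {x y : Q} (h : x = y) (v : TangentSpace 𝓘(ℝ, E) x) :
    (tangentCast h v : E) = v := by
  subst h
  rfl

lemma linearizedAction_eq_mfderiv {q : Q} (hq : ∀ g : Γ, g • q = q) (g : Γ) :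
    (linearizedAction hq g : E →L[ℝ] E) = mfderiv 𝓘(ℝ, E) 𝓘(ℝ, E) (fun y : Q => g • y) q :=
  ContinuousLinearMap.ext fun _ => tangentCast_apply (hq g) _

/-- The linearized action at a fixed point as a representation on the model space `E`, to which
`T_q Q` is definitionally equal. -/
def isotropyRep {q : Q} (hq : ∀ g : Γ, g • q = q)
    (hd : ∀ g : Γ, MDifferentiable 𝓘(ℝ, E) 𝓘(ℝ, E) (fun y : Q => g • y)) : Γ →* (E →L[ℝ] E) where
  toFun g := linearizedAction hq g
  map_one' := by
    have hone : (fun y : Q => (1 : Γ) • y) = id := funext fun y => one_smul Γ y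
    rw [linearizedAction_eq_mfderiv, hone]
    exact mfderiv_id
  map_mul' g h := by
    have hmul : (fun y : Q => (g * h) • y) = (fun y : Q => g • y) ∘ fun y : Q => h • y :=
      funext fun y => mul_smul g h y
    have hcomp := mfderiv_comp (I := 𝓘(ℝ, E)) (I' := 𝓘(ℝ, E)) (I'' := 𝓘(ℝ, E)) q
      (g := fun y : Q => g • y) (f := fun y : Q => h • y) (hd g (h • q)) (hd h q)
    rw [linearizedAction_eq_mfderiv, linearizedAction_eq_mfderiv, linearizedAction_eq_mfderiv, hmul,
      hcomp, hq h]
    rfl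

variable {q : Q} (hq : ∀ g : Γ, g • q = q)
  (hd : ∀ g : Γ, MDifferentiable 𝓘(ℝ, E) 𝓘(ℝ, E) (fun y : Q => g • y))

lemma hasFDerivAt_chartAt_smul (g : Γ) :
    HasFDerivAt (fun y => chartAt E q (g • (chartAt E q).symm y)) (isotropyRep hq hd g)
      (chartAt E q q) := by
  have hderiv : HasFDerivWithinAt (writtenInExtChartAt 𝓘(ℝ, E) 𝓘(ℝ, E) q fun y : Q => g • y)
      (mfderiv 𝓘(ℝ, E) 𝓘(ℝ, E) (fun y : Q => g • y) q) (range 𝓘(ℝ, E))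
      (extChartAt 𝓘(ℝ, E) q q) := (hd g q).hasMFDerivAt.2
  simp only [mfld_simps, writtenInExtChartAt, hq g] at hderiv
  exact (hasFDerivWithinAt_univ.1 hderiv).congr_fderiv (linearizedAction_eq_mfderiv hq g).symm

variable [TopologicalSpace Γ]
  {G : Type*} [NormedAddCommGroup G] [NormedSpace ℝ G] {H : Type*} [TopologicalSpace H]
  (J : ModelWithCorners ℝ G H) [ChartedSpace H Γ]

lemma contMDiffOn_chart_smul_symm [ContMDiffSMul J 𝓘(ℝ, E) ∞ Γ Q] {e : OpenPartialHomeomorph Q E}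
    (he : e ∈ IsManifold.maximalAtlas 𝓘(ℝ, E) ∞ Q) :
    ContMDiffOn (J.prod 𝓘(ℝ, E)) 𝓘(ℝ, E) ∞ (uncurry fun (g : Γ) y => e (g • e.symm y))
      (univ ×ˢ invariantTarget Γ e) := by
  have hsymm : ContMDiffOn (J.prod 𝓘(ℝ, E)) 𝓘(ℝ, E) ∞ (fun p : Γ × E => e.symm p.2)
      (univ ×ˢ invariantTarget Γ e) :=
    (contMDiffOn_symm_of_mem_maximalAtlas he).comp contMDiffOn_snd fun p hp => hp.2.1
  exact (contMDiffOn_of_mem_maximalAtlas he).comp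
    ((contMDiff_smul (I := J) (I' := 𝓘(ℝ, E)) (n := ∞)).comp_contMDiffOn
      (contMDiffOn_fst.prodMk hsymm)) fun p hp => hp.2.2 p.1

variable [CompactSpace Γ] [IsManifold 𝓘(ℝ, E) ∞ Q] [IsManifold J 1 Γ]
  [ContMDiffSMul J 𝓘(ℝ, E) ∞ Γ Q]

lemma contMDiff_isotropyRep : ContMDiff J 𝓘(ℝ, E →L[ℝ] E) ∞ (isotropyRep hq hd) := by
  have := ContMDiffSMul.continuousSMul (G := Γ) (M := Q) (I := J) (I' := 𝓘(ℝ, E)) ∞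
  have hderiv : ⇑(isotropyRep hq hd) = fun g =>
      fderiv ℝ (fun y => chartAt E q (g • (chartAt E q).symm y)) (chartAt E q q) :=
    funext fun g => (hasFDerivAt_chartAt_smul hq hd g).fderiv.symm
  rw [hderiv, ← contMDiffOn_univ]
  exact (contMDiffOn_fderiv_snd (isOpen_invariantTarget _)
    (contMDiffOn_chart_smul_symm J (IsManifold.chart_mem_maximalAtlas q))).comp
    (contMDiff_id.prodMk contMDiff_const).contMDiffOn fun g _ =>
      ⟨mem_univ g, map_mem_invariantTarget (mem_invariantCore_of_fixed hq (mem_chart_source E q))⟩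

include J in
lemma bddAbove_range_norm_isotropyRep : BddAbove (range fun g => ‖isotropyRep hq hd g‖) :=
  (isCompact_range (contMDiff_isotropyRep hq hd J).continuous.norm).bddAbove

end Isotropy

section AveragedChart

variable {E : Type*} [NormedAddCommGroup E] [NormedSpace ℝ E]
  {Q : Type*} [TopologicalSpace Q] [ChartedSpace E Q] {Γ : Type*} [Group Γ] [MulAction Γ Q]
  {q : Q} (hq : ∀ g : Γ, g • q = q)
  (hd : ∀ g : Γ, MDifferentiable 𝓘(ℝ, E) 𝓘(ℝ, E) (fun y : Q => g • y))
  [MeasurableSpace Γ] (μ : Measure Γ)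

/-- The average over `Γ` of the translates of the preferred chart at the fixed point `q`. For an
invariant measure `μ` it intertwines the action with its linearization. -/
def averagedChart (x : Q) : E :=
  ∫ g, isotropyRep hq hd g (chartAt E q (g⁻¹ • x) - chartAt E q q) ∂μ

lemma averagedChart_self : averagedChart hq hd μ q = 0 := by
  simp only [averagedChart, hq, sub_self, map_zero, integral_zero]

lemma averagedChart_smul [TopologicalSpace Γ] [IsTopologicalGroup Γ] [CompactSpace Γ]
    [BorelSpace Γ] [ContinuousSMul Γ Q] [CompleteSpace E] [IsFiniteMeasure μ]
    [μ.IsMulLeftInvariant] (hρ : Continuous (isotropyRep hq hd)) {x : Q}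
    (hx : x ∈ invariantCore Γ (chartAt E q).source) (h : Γ) :
    averagedChart hq hd μ (h • x) = isotropyRep hq hd h (averagedChart hq hd μ x) := by
  have hcont : Continuous fun g : Γ =>
      isotropyRep hq hd g (chartAt E q (g⁻¹ • x) - chartAt E q q) :=
    hρ.clm_apply (((chartAt E q).continuousOn.comp_continuous
      (continuous_inv.smul continuous_const) fun g => hx g⁻¹).sub continuous_const)
  have hint : Integrable (fun g : Γ => isotropyRep hq hd g (chartAt E q (g⁻¹ • x) - chartAt E q q))
      μ := integrable_continuousMap μ ⟨_, hcont⟩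
  rw [averagedChart, averagedChart, ← integral_mul_left_eq_self _ h,
    ← ContinuousLinearMap.integral_comp_comm _ hint]
  simp only [mul_inv_rev, map_mul, mul_apply_eq_comp, mul_smul, inv_smul_smul]

variable [IsManifold 𝓘(ℝ, E) ∞ Q] [TopologicalSpace Γ] [CompactSpace Γ]
  {G : Type*} [NormedAddCommGroup G] [NormedSpace ℝ G] {H : Type*} [TopologicalSpace H]
  (J : ModelWithCorners ℝ G H) [ChartedSpace H Γ] [LieGroup J ∞ Γ] [ContMDiffSMul J 𝓘(ℝ, E) ∞ Γ Q]

omit [MeasurableSpace Γ] in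
lemma contMDiffOn_isotropyRep_chartAt_sub :
    ContMDiffOn (J.prod 𝓘(ℝ, E)) 𝓘(ℝ, E) ∞ (uncurry fun (g : Γ) y =>
        isotropyRep hq hd g (chartAt E q (g⁻¹ • (chartAt E q).symm y) - chartAt E q q))
      (univ ×ˢ invariantTarget Γ (chartAt E q)) := by
  have hinv : ContMDiff (J.prod 𝓘(ℝ, E)) (J.prod 𝓘(ℝ, E)) ∞ fun p : Γ × E => (p.1⁻¹, p.2) :=
    ((contMDiff_inv J ∞).comp contMDiff_fst).prodMk contMDiff_snd
  have hchart := (contMDiffOn_chart_smul_symm (Γ := Γ) J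
    (IsManifold.chart_mem_maximalAtlas (I := 𝓘(ℝ, E)) (n := ∞) q)).comp hinv.contMDiffOn
    (s := univ ×ˢ invariantTarget Γ (chartAt E q)) fun p hp => ⟨mem_univ _, hp.2⟩
  exact ((contMDiff_isotropyRep hq hd J).comp contMDiff_fst).contMDiffOn.clm_apply
    (hchart.sub contMDiffOn_const)

variable [BorelSpace Γ]
include J

lemma contDiffOn_averagedChart_symm [IsFiniteMeasure μ] :
    ContDiffOn ℝ ∞ (averagedChart hq hd μ ∘ (chartAt E q).symm)
      (invariantTarget Γ (chartAt E q)) := by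
  have := ContMDiffSMul.continuousSMul (G := Γ) (M := Q) (I := J) (I' := 𝓘(ℝ, E)) ∞
  exact contDiffOn_integral μ (isOpen_invariantTarget _)
    (contMDiffOn_isotropyRep_chartAt_sub hq hd J)

lemma hasFDerivAt_averagedChart_symm [CompleteSpace E] [IsProbabilityMeasure μ] :
    HasFDerivAt (averagedChart hq hd μ ∘ (chartAt E q).symm) (ContinuousLinearMap.id ℝ E)
      (chartAt E q q) := by
  have := ContMDiffSMul.continuousSMul (G := Γ) (M := Q) (I := J) (I' := 𝓘(ℝ, E)) ∞
  have hderiv (g : Γ) : fderiv ℝ (fun y =>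
      isotropyRep hq hd g (chartAt E q (g⁻¹ • (chartAt E q).symm y) - chartAt E q q))
      (chartAt E q q) = ContinuousLinearMap.id ℝ E := by
    have hcomp := (isotropyRep hq hd g).hasFDerivAt.comp (chartAt E q q)
      ((hasFDerivAt_chartAt_smul hq hd g⁻¹).sub_const (chartAt E q q))
    have hmul : isotropyRep hq hd g * isotropyRep hq hd g⁻¹ = 1 := by
      rw [← map_mul, mul_inv_cancel, map_one]
    exact hcomp.fderiv.trans hmul
  refine (hasFDerivAt_integral μ (isOpen_invariantTarget _)
    (contMDiffOn_isotropyRep_chartAt_sub hq hd J) (map_mem_invariantTarget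
      (mem_invariantCore_of_fixed hq (mem_chart_source E q)))).congr_fderiv ?_
  simp only [hderiv, integral_const, probReal_univ, one_smul]

end AveragedChart

section EquivariantChart

variable {E : Type*} [NormedAddCommGroup E] [NormedSpace ℝ E]
  {Q : Type*} [TopologicalSpace Q] [ChartedSpace E Q] {Γ : Type*} [Group Γ] [MulAction Γ Q]

/-- A smooth chart on an invariant neighborhood of `q`, centered at `q`, in which the action of `Γ`
is the linear action `ρ`. -/
structure IsEquivariantChart (ρ : Γ →* (E →L[ℝ] E)) (q : Q) (e : OpenPartialHomeomorph Q E) :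
    Prop where
  mem_maximalAtlas : e ∈ IsManifold.maximalAtlas 𝓘(ℝ, E) ∞ Q
  mem_source : q ∈ e.source
  map_base : e q = 0
  smul_mem : ∀ g : Γ, ∀ x ∈ e.source, g • x ∈ e.source
  map_smul : ∀ g : Γ, ∀ x ∈ e.source, e (g • x) = ρ g (e x)

lemma isEquivariantChart_restr_invariantCore [TopologicalSpace Γ] [CompactSpace Γ]
    [ContinuousSMul Γ Q] {ρ : Γ →* (E →L[ℝ] E)} {q : Q} (hq : ∀ g : Γ, g • q = q)
    {e : OpenPartialHomeomorph Q E} (he : e ∈ IsManifold.maximalAtlas 𝓘(ℝ, E) ∞ Q)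
    (hqe : q ∈ e.source) (h0 : e q = 0)
    (hρ : ∀ g : Γ, ∀ x ∈ invariantCore Γ e.source, e (g • x) = ρ g (e x)) :
    IsEquivariantChart ρ q (e.restr (invariantCore Γ e.source)) := by
  have hopen : IsOpen (invariantCore Γ e.source) := isOpen_invariantCore e.open_source
  have hsource : (e.restr (invariantCore Γ e.source)).source = invariantCore Γ e.source := by
    rw [e.restr_source' _ hopen, inter_eq_right.2 (invariantCore_subset _)]
  refine ⟨restr_mem_maximalAtlas _ he hopen, ?_, h0, ?_, ?_⟩ <;> rw [hsource]
  · exact mem_invariantCore_of_fixed hq hqe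
  · exact fun g x hx => smul_mem_invariantCore hx g
  · exact hρ

variable [IsManifold 𝓘(ℝ, E) ∞ Q]

lemma trans_mem_maximalAtlas {e : OpenPartialHomeomorph Q E}
    (he : e ∈ IsManifold.maximalAtlas 𝓘(ℝ, E) ∞ Q) {P : OpenPartialHomeomorph E E}
    (hP : ContDiffOn ℝ ∞ P P.source) (hPsymm : ContDiffOn ℝ ∞ P.symm P.target) :
    e.trans P ∈ IsManifold.maximalAtlas 𝓘(ℝ, E) ∞ Q :=
  (e.trans P).mem_maximalAtlas_of_contMDiffOn
    (hP.contMDiffOn.comp ((contMDiffOn_of_mem_maximalAtlas he).mono fun _ hx => hx.1)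
      fun _ hx => hx.2)
    ((contMDiffOn_symm_of_mem_maximalAtlas he).comp (hPsymm.contMDiffOn.mono fun _ hy => hy.1)
      fun _ hy => hy.2)

lemma IsEquivariantChart.trans {ρ : Γ →* (E →L[ℝ] E)} {q : Q} {e : OpenPartialHomeomorph Q E}
    (he : IsEquivariantChart ρ q e) {f : OpenPartialHomeomorph E E}
    (hf : IsEquivariantLocalDiffeo ρ f) : IsEquivariantChart ρ q (e.trans f) where
  mem_maximalAtlas := trans_mem_maximalAtlas he.mem_maximalAtlas hf.contDiffOn hf.contDiffOn_symm
  mem_source := ⟨he.mem_source, mem_preimage.2 (he.map_base.symm ▸ hf.zero_mem)⟩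
  map_base := (congrArg f he.map_base).trans hf.map_zero
  smul_mem g x hx := ⟨he.smul_mem g x hx.1,
    mem_preimage.2 (he.map_smul g x hx.1 ▸ hf.mapsTo g hx.2)⟩
  map_smul g x hx := (congrArg f (he.map_smul g x hx.1)).trans (hf.map_apply g _ hx.2)

variable [CompleteSpace E] [TopologicalSpace Γ] [CompactSpace Γ]
  {G : Type*} [NormedAddCommGroup G] [NormedSpace ℝ G] {H : Type*} [TopologicalSpace H]
  (J : ModelWithCorners ℝ G H) [ChartedSpace H Γ] [LieGroup J ∞ Γ] [ContMDiffSMul J 𝓘(ℝ, E) ∞ Γ Q]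
  {q : Q} (hq : ∀ g : Γ, g • q = q)
  (hd : ∀ g : Γ, MDifferentiable 𝓘(ℝ, E) 𝓘(ℝ, E) (fun y : Q => g • y))
include J

lemma exists_mem_maximalAtlas_eq_averagedChart [MeasurableSpace Γ] [BorelSpace Γ] (μ : Measure Γ)
    [IsProbabilityMeasure μ] :
    ∃ e ∈ IsManifold.maximalAtlas 𝓘(ℝ, E) ∞ Q, q ∈ e.source ∧
      e.source ⊆ (chartAt E q).source ∧ EqOn e (averagedChart hq hd μ) e.source := by
  have := ContMDiffSMul.continuousSMul (G := Γ) (M := Q) (I := J) (I' := 𝓘(ℝ, E)) ∞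
  have hsmooth := contDiffOn_averagedChart_symm hq hd μ J
  obtain ⟨P, hqP, hPsub, hP, hPsymm⟩ := exists_openPartialHomeomorph_contDiffOn_symm
    (isOpen_invariantTarget _) (map_mem_invariantTarget
      (mem_invariantCore_of_fixed hq (mem_chart_source E q))) hsmooth
    (ContinuousLinearEquiv.refl ℝ E) (hasFDerivAt_averagedChart_symm hq hd μ J)
  refine ⟨(chartAt E q).trans P, trans_mem_maximalAtlas (IsManifold.chart_mem_maximalAtlas q)
    (hP ▸ hsmooth.mono hPsub) hPsymm, ⟨mem_chart_source E q, hqP⟩, fun x hx => hx.1, fun x hx => ?_⟩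
  rw [OpenPartialHomeomorph.coe_trans, hP, comp_apply, comp_apply, (chartAt E q).left_inv hx.1]

/-- **Bochner's linearization theorem**. -/
theorem exists_isEquivariantChart :
    ∃ e, IsEquivariantChart (isotropyRep hq hd) q e ∧
      HasMFDerivAt 𝓘(ℝ, E) 𝓘(ℝ, E) e q (ContinuousLinearMap.id ℝ E) := by
  have := ContMDiffSMul.continuousSMul (G := Γ) (M := Q) (I := J) (I' := 𝓘(ℝ, E)) ∞
  have := topologicalGroup_of_lieGroup J ∞ (G := Γ)
  let : MeasurableSpace Γ := borel Γ
  have : BorelSpace Γ := ⟨rfl⟩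
  let μ : Measure Γ := Measure.haarMeasure ⊤
  have : IsProbabilityMeasure μ := ⟨Measure.haarMeasure_self⟩
  obtain ⟨e, he, hqe, hsource, hμ⟩ := exists_mem_maximalAtlas_eq_averagedChart J hq hd μ
  refine ⟨_, isEquivariantChart_restr_invariantCore hq he hqe ?_ fun g x hx => ?_, ?_, ?_⟩
  · exact (hμ hqe).trans (averagedChart_self hq hd μ)
  · rw [hμ (invariantCore_subset _ (smul_mem_invariantCore hx g)), hμ (invariantCore_subset _ hx)]
    exact averagedChart_smul hq hd μ (contMDiff_isotropyRep hq hd J).continuous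
      (fun g => hsource (hx g)) g
  · exact e.continuousAt hqe
  · have hnhds : (chartAt E q).symm ⁻¹' e.source ∈ 𝓝 (chartAt E q q) :=
      ((chartAt E q).symm.continuousAt (mem_chart_target E q)).preimage_mem_nhds (by
        simpa using e.open_source.mem_nhds hqe)
    simp only [mfld_simps, writtenInExtChartAt]
    refine HasFDerivAt.hasFDerivWithinAt (HasFDerivAt.congr_of_eventuallyEq
      (hasFDerivAt_averagedChart_symm hq hd μ J) ?_)
    filter_upwards [hnhds] with y hy using hμ hy

end EquivariantChart

section Pullback

variable {E : Type*} [NormedAddCommGroup E] [NormedSpace ℝ E]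
  {M N Q : Type*} [TopologicalSpace M] [ChartedSpace E M] [TopologicalSpace N] [ChartedSpace E N]
  [TopologicalSpace Q] [ChartedSpace E Q]

/-- The pullback `φ^*Ω` of a 2-form. It has the junk value `0` at the points where `φ` is not
differentiable. -/
def TwoForm.pullback (Ω : TwoForm E Q) (φ : M → Q) : TwoForm E M := fun x =>
  (Ω (φ x)).compContinuousLinearMap (mfderiv 𝓘(ℝ, E) 𝓘(ℝ, E) φ x)

lemma TwoForm.pullback_eq_comp_of_hasMFDerivAt (Ω : TwoForm E Q) {φ : M → Q} {x : M}
    {A : E →L[ℝ] E} (hφ : HasMFDerivAt 𝓘(ℝ, E) 𝓘(ℝ, E) φ x A) :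
    Ω.pullback φ x = (Ω (φ x)).compContinuousLinearMap A :=
  congrArg _ hφ.mfderiv

lemma TwoForm.pullback_congr_of_eventuallyEq (Ω : TwoForm E Q) {φ ψ : M → Q} {x : M}
    (h : φ =ᶠ[𝓝 x] ψ) : Ω.pullback φ x = Ω.pullback ψ x := by
  change ContinuousAlternatingMap.compContinuousLinearMap
      ((Ω : Q → E [⋀^Fin 2]→L[ℝ] ℝ) (φ x)) _ = ContinuousAlternatingMap.compContinuousLinearMap
      ((Ω : Q → E [⋀^Fin 2]→L[ℝ] ℝ) (ψ x)) _
  rw [h.eq_of_nhds, h.mfderiv_eq]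

lemma TwoForm.pullback_id (Ω : TwoForm E Q) : Ω.pullback id = Ω := by
  ext x v
  simp [pullback]

lemma TwoForm.pullback_pullback_apply (Ω : TwoForm E Q) {φ : N → Q} {ψ : M → N} {x : M}
    (hφ : MDifferentiableAt 𝓘(ℝ, E) 𝓘(ℝ, E) φ (ψ x))
    (hψ : MDifferentiableAt 𝓘(ℝ, E) 𝓘(ℝ, E) ψ x) :
    (Ω.pullback φ).pullback ψ x = Ω.pullback (φ ∘ ψ) x :=
  congrArg (Ω (φ (ψ x))).compContinuousLinearMap (mfderiv_comp x hφ hψ).symm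

lemma TwoForm.IsInvariant.pullback_smul {Γ : Type*} [SMul Γ Q] {Ω : TwoForm E Q}
    (hΩ : Ω.IsInvariant Γ) (g : Γ) : Ω.pullback (fun x => g • x) = Ω :=
  funext (hΩ g)

variable {e : OpenPartialHomeomorph Q E}

lemma mdifferentiableAt_of_mem_maximalAtlas (he : e ∈ IsManifold.maximalAtlas 𝓘(ℝ, E) ∞ Q) {x : Q}
    (hx : x ∈ e.source) : MDifferentiableAt 𝓘(ℝ, E) 𝓘(ℝ, E) e x :=
  (contMDiffAt_of_mem_maximalAtlas he hx).mdifferentiableAt (by simp)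

lemma mdifferentiableAt_symm_of_mem_maximalAtlas (he : e ∈ IsManifold.maximalAtlas 𝓘(ℝ, E) ∞ Q)
    {y : E} (hy : y ∈ e.target) : MDifferentiableAt 𝓘(ℝ, E) 𝓘(ℝ, E) e.symm y :=
  (contMDiffAt_symm_of_mem_maximalAtlas he hy).mdifferentiableAt (by simp)

lemma TwoForm.pullback_inChart (Ω : TwoForm E Q) (he : e ∈ IsManifold.maximalAtlas 𝓘(ℝ, E) ∞ Q)
    {x : Q} (hx : x ∈ e.source) : TwoForm.pullback (Ω.inChart e : TwoForm E E) e x = Ω x := by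
  have hleft : e.symm ∘ e =ᶠ[𝓝 x] id := by
    filter_upwards [e.open_source.mem_nhds hx] with z hz using e.left_inv hz
  calc (Ω.pullback e.symm).pullback e x = Ω.pullback (e.symm ∘ e) x :=
        Ω.pullback_pullback_apply (mdifferentiableAt_symm_of_mem_maximalAtlas he (e.map_source hx))
          (mdifferentiableAt_of_mem_maximalAtlas he hx)
    _ = Ω x := by rw [Ω.pullback_congr_of_eventuallyEq hleft, Ω.pullback_id]

variable {Γ : Type*} [Group Γ] [MulAction Γ Q] {ρ : Γ →* (E →L[ℝ] E)} {q : Q}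

lemma IsEquivariantChart.inChart_zero (he : IsEquivariantChart ρ q e)
    (hid : HasMFDerivAt 𝓘(ℝ, E) 𝓘(ℝ, E) e q (ContinuousLinearMap.id ℝ E)) (Ω : TwoForm E Q) :
    Ω.inChart e 0 = Ω q := by
  rw [← he.map_base]
  exact (TwoForm.pullback_eq_comp_of_hasMFDerivAt (Ω.inChart e) hid).symm.trans
    (Ω.pullback_inChart he.mem_maximalAtlas he.mem_source)

lemma IsEquivariantChart.symm_map (he : IsEquivariantChart ρ q e) (g : Γ) {y : E}
    (hy : y ∈ e.target) : ρ g y ∈ e.target ∧ e.symm (ρ g y) = g • e.symm y := by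
  have hx := e.map_target hy
  rw [← e.right_inv hy, ← he.map_smul g _ hx, e.right_inv hy]
  exact ⟨e.map_source (he.smul_mem g _ hx), e.left_inv (he.smul_mem g _ hx)⟩

lemma IsEquivariantChart.inChart_comp (he : IsEquivariantChart ρ q e) {Ω : TwoForm E Q}
    (hΩ : Ω.IsInvariant Γ) {g : Γ}
    (hd : MDifferentiable 𝓘(ℝ, E) 𝓘(ℝ, E) (fun y : Q => g • y)) {y : E} (hy : y ∈ e.target) :
    (Ω.inChart e (ρ g y)).compContinuousLinearMap (ρ g) = Ω.inChart e y := by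
  have hsymm : e.symm ∘ ρ g =ᶠ[𝓝 y] (fun x : Q => g • x) ∘ e.symm := by
    filter_upwards [e.open_target.mem_nhds hy] with z hz using (he.symm_map g hz).2
  have hdρ : HasMFDerivAt 𝓘(ℝ, E) 𝓘(ℝ, E) (ρ g) y (ρ g) := (ρ g).hasFDerivAt.hasMFDerivAt
  have hde {z : E} (hz : z ∈ e.target) : MDifferentiableAt 𝓘(ℝ, E) 𝓘(ℝ, E) e.symm z :=
    mdifferentiableAt_symm_of_mem_maximalAtlas he.mem_maximalAtlas hz
  refine (TwoForm.pullback_eq_comp_of_hasMFDerivAt (Ω.inChart e) hdρ).symm.trans ?_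
  calc (Ω.pullback e.symm).pullback (ρ g) y
      = Ω.pullback (e.symm ∘ ρ g) y :=
        Ω.pullback_pullback_apply (hde (he.symm_map g hy).1) hdρ.mdifferentiableAt
    _ = Ω.pullback ((fun x : Q => g • x) ∘ e.symm) y := Ω.pullback_congr_of_eventuallyEq hsymm
    _ = (Ω.pullback fun x => g • x).pullback e.symm y :=
        (Ω.pullback_pullback_apply (hd _) (hde hy)).symm
    _ = Ω.pullback e.symm y := by rw [hΩ.pullback_smul]

end Pullback

section Darboux

variable {E : Type*} [NormedAddCommGroup E] [NormedSpace ℝ E]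

lemma isInvertible_curryLeftCLM_of_nondegenerate [FiniteDimensional ℝ E]
    {η : E [⋀^Fin 2]→L[ℝ] ℝ} (hη : ∀ v, (∀ w, η ![v, w] = 0) → v = 0) :
    (curryLeftCLM ℝ E ℝ 1 η).IsInvertible := by
  let dual : (E →ₗ[ℝ] ℝ) ≃ₗ[ℝ] E [⋀^Fin 1]→L[ℝ] ℝ := LinearMap.toContinuousLinearMap.trans
    (ContinuousAlternatingMap.ofSubsingletonLIE (0 : Fin 1)).toLinearEquiv
  have : FiniteDimensional ℝ (E [⋀^Fin 1]→L[ℝ] ℝ) := dual.finiteDimensional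
  have hinj : Injective (curryLeftCLM ℝ E ℝ 1 η).toLinearMap :=
    (injective_iff_map_eq_zero _).2 fun v hv => hη v fun w => congrArg (· ![w]) hv
  have hdim : Module.finrank ℝ E = Module.finrank ℝ (E [⋀^Fin 1]→L[ℝ] ℝ) :=
    Subspace.dual_finrank_eq.symm.trans dual.finrank_eq
  exact ⟨(LinearMap.linearEquivOfInjective _ hinj hdim).toContinuousLinearEquiv, rfl⟩

variable [FiniteDimensional ℝ E]
  {Q : Type*} [TopologicalSpace Q] [ChartedSpace E Q] [IsManifold 𝓘(ℝ, E) ∞ Q]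
  {G : Type*} [NormedAddCommGroup G] [NormedSpace ℝ G] {H : Type*} [TopologicalSpace H]
  (J : ModelWithCorners ℝ G H) {Γ : Type*} [TopologicalSpace Γ] [CompactSpace Γ] [ChartedSpace H Γ]
  [Group Γ] [LieGroup J ∞ Γ] [MulAction Γ Q] [ContMDiffSMul J 𝓘(ℝ, E) ∞ Γ Q]
  {q : Q} (hq : ∀ g : Γ, g • q = q)
  (hd : ∀ g : Γ, MDifferentiable 𝓘(ℝ, E) 𝓘(ℝ, E) (fun y : Q => g • y))
include J

theorem exists_isEquivariantChart_pullback_const_eq {Ω : TwoForm E Q} (hΩ : Ω.IsSymplectic)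
    (hinv : Ω.IsInvariant Γ) :
    ∃ e, IsEquivariantChart (isotropyRep hq hd) q e ∧
      ∀ x ∈ e.source, TwoForm.pullback (fun _ : E => Ω q : TwoForm E E) e x = Ω x := by
  obtain ⟨e, he, hid⟩ := exists_isEquivariantChart J hq hd
  have h0 : Ω.inChart e 0 = Ω q := he.inChart_zero hid Ω
  obtain ⟨f, hf, -, hpull⟩ := exists_isEquivariantLocalDiffeo_pullback_eq
    (bddAbove_range_norm_isotropyRep hq hd J) e.open_target
    (he.map_base ▸ e.map_source he.mem_source) (hΩ.smooth e he.mem_maximalAtlas)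
    (hΩ.closed e he.mem_maximalAtlas)
    (isInvertible_curryLeftCLM_of_nondegenerate (h0 ▸ hΩ.nondegenerate q))
    fun g x hx _ => he.inChart_comp hinv (hd g) hx
  refine ⟨e.trans f, he.trans hf, fun x ⟨hxe, hxf⟩ => ?_⟩
  have hdf : HasMFDerivAt 𝓘(ℝ, E) 𝓘(ℝ, E) f (e x) (fderiv ℝ f (e x)) :=
    ((hf.contDiffOn.contDiffAt (f.open_source.mem_nhds hxf)).differentiableAt
      (by simp)).hasFDerivAt.hasMFDerivAt
  calc TwoForm.pullback (fun _ : E => Ω q : TwoForm E E) (f ∘ e) x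
      = (TwoForm.pullback (fun _ : E => Ω q : TwoForm E E) f).pullback e x :=
        (TwoForm.pullback_pullback_apply _ hdf.mdifferentiableAt
          (mdifferentiableAt_of_mem_maximalAtlas he.mem_maximalAtlas hxe)).symm
    _ = TwoForm.pullback (Ω.inChart e : TwoForm E E) e x := by
        refine congrArg (fun σ : E [⋀^Fin 2]→L[ℝ] ℝ => σ.compContinuousLinearMap _) ?_
        rw [← hpull (e x) hxf, h0]
        exact TwoForm.pullback_eq_comp_of_hasMFDerivAt _ hdf
    _ = Ω x := Ω.pullback_inChart he.mem_maximalAtlas hxe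

end Darboux

section TangentChart

variable {E : Type*} [NormedAddCommGroup E] [NormedSpace ℝ E]
  {Q : Type*} [TopologicalSpace Q] [ChartedSpace E Q]

/-- The chart `e` regarded as a map to `T_q Q`, which is identified with the model space by
`tangentModel q`. -/
def tangentChart (q : Q) (e : OpenPartialHomeomorph Q E) :
    OpenPartialHomeomorph Q (TangentSpace 𝓘(ℝ, E) q) :=
  e.transHomeomorph (tangentModel q).symm.toHomeomorph

lemma isSymplectomorphismToTangent_tangentChart {q : Q} {e : OpenPartialHomeomorph Q E}
    (he : e ∈ IsManifold.maximalAtlas 𝓘(ℝ, E) ∞ Q) {Ω : TwoForm E Q}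
    (hΩ : ∀ x ∈ e.source, TwoForm.pullback (fun _ : E => Ω q : TwoForm E E) e x = Ω x) :
    IsSymplectomorphismToTangent Ω (tangentChart q e) where
  smooth := contMDiffOn_of_mem_maximalAtlas he
  smooth_symm := contMDiffOn_symm_of_mem_maximalAtlas he
  pullback := hΩ

end TangentChart

end EquivariantDarboux

end

theorem mainTheorem5
    {E : Type*} [NormedAddCommGroup E] [NormedSpace ℝ E] [FiniteDimensional ℝ E]
    {Q : Type*} [TopologicalSpace Q] [ChartedSpace E Q] [IsManifold 𝓘(ℝ, E) ∞ Q]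
    {F : Type*} [NormedAddCommGroup F] [NormedSpace ℝ F] [FiniteDimensional ℝ F]
    {Γ : Type*} [TopologicalSpace Γ] [ChartedSpace F Γ] [Group Γ] [LieGroup 𝓘(ℝ, F) ∞ Γ]
    [CompactSpace Γ] [MulAction Γ Q] [ContMDiffSMul 𝓘(ℝ, F) 𝓘(ℝ, E) ∞ Γ Q]
    (Ω : TwoForm E Q) (hΩ : Ω.IsSymplectic) (hinv : Ω.IsInvariant Γ)
    (q : Q) (hq : ∀ g : Γ, g • q = q) :
    ∃ (U : Set Q) (V : Set (TangentSpace 𝓘(ℝ, E) q))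
      (f : OpenPartialHomeomorph Q (TangentSpace 𝓘(ℝ, E) q)),
      IsOpen U ∧ q ∈ U ∧ (∀ g : Γ, ∀ x ∈ U, g • x ∈ U) ∧
      IsOpen V ∧ 0 ∈ V ∧ (∀ g : Γ, ∀ v ∈ V, linearizedAction hq g v ∈ V) ∧
      f.source = U ∧ f.target = V ∧
      IsSymplectomorphismToTangent Ω f ∧
      (∀ g : Γ, ∀ x ∈ U, f (g • x) = linearizedAction hq g (f x)) ∧
      f q = 0 := by
  have hd (g : Γ) : MDifferentiable 𝓘(ℝ, E) 𝓘(ℝ, E) fun y : Q => g • y :=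
    ((contMDiff_smul (I := 𝓘(ℝ, F)) (I' := 𝓘(ℝ, E)) (n := ∞)).comp
      ((contMDiff_const (c := g)).prodMk contMDiff_id)).mdifferentiable (by simp)
  obtain ⟨e, he, hpull⟩ := exists_isEquivariantChart_pullback_const_eq 𝓘(ℝ, F) hq hd hΩ hinv
  have h0 : (0 : E) ∈ e.target := he.map_base ▸ e.map_source he.mem_source
  exact ⟨e.source, (tangentChart q e).target, tangentChart q e, e.open_source, he.mem_source,
    he.smul_mem, (tangentChart q e).open_target, h0, fun g v hv => (he.symm_map g hv).1, rfl, rfl,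
    isSymplectomorphismToTangent_tangentChart he.mem_maximalAtlas hpull, he.map_smul, he.map_base⟩
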